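/- Let $D_2=\begin{pmatrix}2&0\\0&2\end{pmatrix}$, $S_0=[-\pi,\pi)\times[-\pi,\pi)$ and $\Gamma=\{(0,0),(0,\pi),(\pi,0),(\pi,\pi)\}$. Let $M_0(\xi)=\sum_{n\in\mathbb{Z}^2}c_n e^{-i n\cdot\xi}$ (finitely many $c_n\in\mathbb{C}$ nonzero) be a trigonometric polynomial on $\mathbb{R}^2$ with $M_0(0)=1$. Call $\varphi\in L^2(\mathbb{R}^2)$ the scaling function defined by $M_0$ if $$\hat\varphi(\xi)=\frac1{2\pi}\prod_{k=1}^{\infty}M_0(D_2^{-k}\xi)\quad\text{for a.e. }\xi\in\mathbb{R}^2,$$ where $\hat\varphi$ is the unitary Fourier transform, $\hat\varphi(\xi)=\frac1{2\pi}\int_{\mathbb{R}^2}\varphi(x)e^{-ix\cdot\xi}\,dx$ for $\varphi\in L^1\cap L^2$. 1. If $\varphi\in L^2(\mathbb{R}^2)$ is the scaling function defined by $M_0$ and its integer shifts $\varphi(\cdot-n)$, $n\in\mathbb{Z}^2$, are orthonormal, then there is a compact set $K\subset\mathbb{R}^2$, containing a neighborhood of $0$ and congruent to $S_0$ modulo $2\pi$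 (that is, $K$ has Lebesgue measure $(2\pi)^2$, and for every $\xi\in S_0$ there is $n\in\mathbb{Z}^2$ with $\xi+2\pi n\in K$), such that $$\inf_{k>0,\ \xi\in K}|M_0(D_2^{-k}\xi)|>0 .$$ 2. Conversely, suppose that $\sum_{\gamma\in\Gamma}|M_0(\xi+\gamma)|^2=1$ for all $\xi\in\mathbb{R}^2$. Then a scaling function $\varphi\in L^2(\mathbb{R}^2)$ defined by $M_0$ exists; and if there is a set $K\subset\mathbb{R}^2$ (not necessarily compact or of measure $(2\pi)^2$) that contains a neighborhood of $0$, contains for every $\xi\in S_0$ some $\xi+2\pi n$ with $n\in\mathbb{Z}^2$, and satisfies $\inf_{k>0,\ \xi\in K}|M_0(D_2^{-k}\xi)|>0$, then the shifts $\varphi(\cdot-n)$, $n\in\mathbb{Z}^2$, are orthonormal. -/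

import Mathlib

open MeasureTheory Topology
open scoped FourierTransform

noncomputable section

namespace QuasiShearlet

/-- The plane `ℝ²` (used both for space and for frequency). -/
abbrev Plane : Type := EuclideanSpace ℝ (Fin 2)

/-- The integer vector `n ∈ ℤ²`, as a point of `ℝ²`. -/
def latticePt (n : Fin 2 → ℤ) : Plane := WithLp.toLp 2 fun i => (n i : ℝ)

/-- `M` is a trigonometric polynomial on `ℝ²`:
`M ξ = ∑ₙ c n * exp (-i n·ξ)`, with finitely many nonzero complex coefficients `c n`, `n ∈ ℤ²`. -/
def IsTrigPoly (M : Plane → ℂ) : Prop :=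
  ∃ c : (Fin 2 → ℤ) →₀ ℂ, ∀ ξ : Plane,
    M ξ = ∑ n ∈ c.support, c n * Complex.exp (-Complex.I * ((inner ℝ (latticePt n) ξ : ℝ) : ℂ))

/-- `D₂⁻ᵏ ξ`, where `D₂ = 2 • I` is the dyadic dilation matrix. -/
def dilInv (k : ℕ) (ξ : Plane) : Plane := ((2 : ℝ) ^ k)⁻¹ • ξ

/-- The infinite product `(2π)⁻¹ ∏_{k ≥ 1} M (D₂⁻ᵏ ξ)`. It converges (unconditionally) at every
`ξ` when `M` is a trigonometric polynomial with `M 0 = 1`: see `multipliable_dilInv`. -/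
def phiHat (M : Plane → ℂ) (ξ : Plane) : ℂ :=
  ((2 * Real.pi : ℝ) : ℂ)⁻¹ * ∏' k : ℕ, M (dilInv (k + 1) ξ)

/-- The Fourier transform on `L²(ℝ²)` in the unitary normalisation
`φ̂ ξ = (2π)⁻¹ ∫ φ x * exp (-i x·ξ) dx`. Mathlib's `𝓕` uses the kernel `exp (-2πi x·ξ)`, whence
the rescaling. -/
def fourierL2 (φ : Lp ℂ 2 (volume : Measure Plane)) (ξ : Plane) : ℂ :=
  ((2 * Real.pi : ℝ) : ℂ)⁻¹ *
    ((𝓕 φ : Lp ℂ 2 (volume : Measure Plane)) : Plane → ℂ) ((2 * Real.pi)⁻¹ • ξ)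

/-- `φ ∈ L²(ℝ²)` is the scaling function defined by `M`: its Fourier transform is the infinite
product `phiHat M`. -/
def IsScalingFunction (M : Plane → ℂ) (φ : Lp ℂ 2 (volume : Measure Plane)) : Prop :=
  ∀ᵐ ξ : Plane, fourierL2 φ ξ = phiHat M ξ

/-- The integer shift `φ(· - n)` of `φ ∈ L²(ℝ²)`. -/
def shift (n : Fin 2 → ℤ) (φ : Lp ℂ 2 (volume : Measure Plane)) :
    Lp ℂ 2 (volume : Measure Plane) :=
  Lp.compMeasurePreserving (fun x : Plane => x - latticePt n)
    (measurePreserving_sub_right volume (latticePt n)) φ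

/-- The frequency square `S₀ = [-π, π) × [-π, π)`. -/
def S₀ : Set Plane := {ξ | ∀ i, ξ i ∈ Set.Ico (-Real.pi) Real.pi}

open Classical in
/-- The set of shifts `Γ = {(0,0), (0,π), (π,0), (π,π)}`. -/
def Γ : Finset Plane :=
  {!₂[0, 0], !₂[0, Real.pi], !₂[Real.pi, 0], !₂[Real.pi, Real.pi]}

/-- Every point of `S₀` has a translate by an element of `2πℤ²` in `K`. -/
def Covers (K : Set Plane) : Prop :=
  ∀ ξ ∈ S₀, ∃ n : Fin 2 → ℤ, ξ + (2 * Real.pi) • latticePt n ∈ K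

/-- `inf_{k > 0, ξ ∈ K} |M (D₂⁻ᵏ ξ)| > 0`. -/
def BoundedBelow (M : Plane → ℂ) (K : Set Plane) : Prop :=
  ∃ c : ℝ, 0 < c ∧ ∀ k : ℕ, 0 < k → ∀ ξ ∈ K, c ≤ ‖M (dilInv k ξ)‖

/-- The factors of the infinite product are unconditionally multipliable at every point. -/
theorem multipliable_dilInv {M : Plane → ℂ} (hM : IsTrigPoly M) (h0 : M 0 = 1) (ξ : Plane) :
    Multipliable fun k : ℕ => M (dilInv (k + 1) ξ) := by
  obtain ⟨c, hc⟩ := hM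
  have key : ∀ η : Plane, ‖M η - 1‖ ≤ ∑ n ∈ c.support, ‖c n‖ * |inner ℝ (latticePt n) η| := by
    intro η
    rw [← h0, hc η, hc 0, ← Finset.sum_sub_distrib]
    refine (norm_sum_le _ _).trans (Finset.sum_le_sum fun n _ => ?_)
    rw [← mul_sub, norm_mul]
    refine mul_le_mul_of_nonneg_left ?_ (norm_nonneg _)
    have := @Real.norm_exp_I_mul_ofReal_sub_one_le (-(inner ℝ (latticePt n) η))
    simpa using this
  have hs : Summable fun k : ℕ => M (dilInv (k + 1) ξ) - 1 := by
    refine Summable.of_norm_bounded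
      (g := fun k : ℕ => (∑ n ∈ c.support, ‖c n‖ * |inner ℝ (latticePt n) ξ|) * (1 / 2) ^ (k + 1))
      ?_ ?_
    · exact ((summable_nat_add_iff 1).2 summable_geometric_two).mul_left _
    · intro k
      refine (key _).trans (le_of_eq ?_)
      rw [Finset.sum_mul]
      refine Finset.sum_congr rfl fun n _ => ?_
      rw [dilInv, inner_smul_right, abs_mul, abs_of_nonneg (by positivity)]
      rw [one_div, inv_pow]
      ring
  have := Complex.multipliable_one_add_of_summable hs
  simpa using this

end QuasiShearlet

end

open QuasiShearlet

/-! Let P be the infinite product and F(ξ) = ∑ₙ |P(ξ + 2πn)|². By Plancherel, the inner products of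
the shifts of φ are, up to the factor (2π)², the Fourier coefficients of the measure |P|² dξ pushed
to the torus. A finite measure there is determined by its coefficients, so orthonormality means F =
1 almost everywhere (`orthonormal_shift_iff`). Since P(ξ) = M(ξ/2) P(ξ/2), F is a fixed point of the
transfer operator of M.

Under the mirror filter identity this operator is an averaging operator. Truncated products, cut off
by a Lipschitz bump and periodised, are its iterates on the bump; they stay in [0, 1] with a common
Lipschitz constant and converge to F. Hence F ≤ 1, which makes P square integrable, and F is
continuous.

For the converse, the bound on K makes P nonzero somewhere on every orbit. From a minimum of F,
choose such a lattice translate; by the averaging property its successive halvings are again minima.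
They tend to 0, where F(0) ≥ |P(0)|² = 1, so F = 1 (`IsQMF.periodize_specDensity_eq_one`).

For the direct part, F = 1 a.e. forces the mirror filter identity, hence continuity of F, hence F =
1 everywhere. The open set {P ≠ 0} therefore meets every orbit, and K is assembled inside it from
translated pieces of the square (`exists_compact_congruent`). -/

namespace QuasiShearlet

open scoped ENNReal
open Filter

/-! ### The lattice, the fundamental square and periodisation -/

lemma latticePt_apply (n : Fin 2 → ℤ) (i : Fin 2) : latticePt n i = n i := rfl

lemma latticePt_add (m n : Fin 2 → ℤ) : latticePt (m + n) = latticePt m + latticePt n := by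
  ext i; simp [latticePt_apply]

lemma latticePt_zero : latticePt 0 = 0 := by
  ext i; simp [latticePt_apply]

lemma latticePt_neg (n : Fin 2 → ℤ) : latticePt (-n) = -latticePt n := by
  ext i; simp [latticePt_apply]

/-- The unique lattice translate in the frequency square. -/
lemma existsUnique_add_mem_S₀ (ξ : Plane) :
    ∃! n : Fin 2 → ℤ, ξ + (2 * Real.pi) • latticePt n ∈ S₀ := by
  have h1 : ∀ i, ∃! m : ℤ, ξ i + m • (2 * Real.pi) ∈
      Set.Ico (-Real.pi) (-Real.pi + 2 * Real.pi) :=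
    fun i => existsUnique_add_zsmul_mem_Ico Real.two_pi_pos _ _
  have h2 : -Real.pi + 2 * Real.pi = Real.pi := by ring
  have key : ∀ (n : Fin 2 → ℤ) i,
      (ξ + (2 * Real.pi) • latticePt n) i = ξ i + n i • (2 * Real.pi) := by
    intro n i; simp [latticePt_apply]; ring
  choose m hm hm' using h1
  refine ⟨m, fun i => ?_, fun n hn => funext fun i => hm' i _ ?_⟩
  · have := hm i
    rw [h2] at this
    rw [key]
    exact this
  · have := hn i
    rw [key] at this
    rw [h2]
    exact this

lemma measurableSet_S₀ : MeasurableSet S₀ := by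
  have : S₀ = ⋂ i, (fun ξ : Plane => ξ i) ⁻¹' Set.Ico (-Real.pi) Real.pi := by
    ext; simp [S₀]
  rw [this]
  exact MeasurableSet.iInter fun i => measurableSet_Ico.preimage (by fun_prop)

lemma S₀_eq_preimage : S₀ = (MeasurableEquiv.toLp 2 (Fin 2 → ℝ)).symm ⁻¹'
    (Set.univ.pi fun _ => Set.Ico (-Real.pi) Real.pi) := by
  ext ξ; simp [S₀]

lemma volume_S₀ : volume S₀ = ENNReal.ofReal ((2 * Real.pi) ^ 2) := by
  rw [S₀_eq_preimage,
    (EuclideanSpace.volume_preserving_symm_measurableEquiv_toLp (Fin 2)).measure_preimage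
      (MeasurableSet.univ_pi fun _ => measurableSet_Ico).nullMeasurableSet, Real.volume_pi_Ico]
  simp only [Fin.prod_univ_two]
  rw [← ENNReal.ofReal_mul (by linarith [Real.pi_pos])]
  ring_nf

/-- The `2πℤ²`-periodisation of a function. -/
noncomputable def periodize (u : Plane → ℝ≥0∞) (ξ : Plane) : ℝ≥0∞ :=
  ∑' n : Fin 2 → ℤ, u (ξ + (2 * Real.pi) • latticePt n)

lemma periodize_add (u : Plane → ℝ≥0∞) (ξ : Plane) (n : Fin 2 → ℤ) :
    periodize u (ξ + (2 * Real.pi) • latticePt n) = periodize u ξ := by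
  unfold periodize
  rw [← (Equiv.addLeft n).tsum_eq (fun m => u (ξ + (2 * Real.pi) • latticePt m))]
  refine tsum_congr fun m => ?_
  rw [Equiv.coe_addLeft, latticePt_add, smul_add, add_assoc]

lemma le_periodize (u : Plane → ℝ≥0∞) (ξ : Plane) : u ξ ≤ periodize u ξ := by
  have := ENNReal.le_tsum (f := fun n => u (ξ + (2 * Real.pi) • latticePt n)) 0
  simpa [latticePt_zero, periodize] using this

lemma measurable_periodize {u : Plane → ℝ≥0∞} (hu : Measurable u) : Measurable (periodize u) := by
  unfold periodize
  exact Measurable.tsum fun n => hu.comp (by fun_prop)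

lemma periodize_mul_of_periodic {u p : Plane → ℝ≥0∞}
    (hp : ∀ ξ (n : Fin 2 → ℤ), p (ξ + (2 * Real.pi) • latticePt n) = p ξ) (ξ : Plane) :
    periodize (fun η => p η * u η) ξ = p ξ * periodize u ξ := by
  simp only [periodize, hp, ENNReal.tsum_mul_left]

/-- Each orbit meets the half-open square exactly once, so a single term survives. -/
lemma periodize_indicator_S₀ {p : Plane → ℝ≥0∞}
    (hp : ∀ ξ (n : Fin 2 → ℤ), p (ξ + (2 * Real.pi) • latticePt n) = p ξ) (ξ : Plane) :
    periodize (S₀.indicator p) ξ = p ξ := by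
  obtain ⟨n, hn, hn'⟩ := existsUnique_add_mem_S₀ ξ
  rw [periodize, tsum_eq_single n]
  · rw [Set.indicator_of_mem hn, hp]
  · intro m hm
    exact Set.indicator_of_notMem (fun h => hm (hn' m h)) _

/-- Unfolding: an integral over the plane is the integral over `S₀` of the periodisation. -/
lemma lintegral_eq_setLIntegral_periodize {u : Plane → ℝ≥0∞} (hu : Measurable u) :
    ∫⁻ ξ, u ξ = ∫⁻ ξ in S₀, periodize u ξ := by
  set A : (Fin 2 → ℤ) → Set Plane := fun n => (fun ξ => ξ + (2 * Real.pi) • latticePt n) ⁻¹' S₀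
  have hA : ∀ n, MeasurableSet (A n) := fun n => measurableSet_S₀.preimage (by fun_prop)
  have hdisj : Pairwise (Function.onFun Disjoint A) := by
    intro m n hmn
    refine Set.disjoint_left.2 fun ξ hm hn => hmn ?_
    exact (existsUnique_add_mem_S₀ ξ).unique hm hn
  have hun : ⋃ n, A n = Set.univ := by
    refine Set.eq_univ_of_forall fun ξ => ?_
    obtain ⟨n, hn, -⟩ := existsUnique_add_mem_S₀ ξ
    exact Set.mem_iUnion.2 ⟨n, hn⟩
  rw [← setLIntegral_univ, ← hun, lintegral_iUnion hA hdisj]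
  have h1 : ∀ n, ∫⁻ ξ in A n, u ξ = ∫⁻ ξ in S₀, u (ξ + (2 * Real.pi) • latticePt (-n)) := by
    intro n
    have := (measurePreserving_add_right (volume : Measure Plane)
      ((2 * Real.pi) • latticePt n)).setLIntegral_comp_preimage_emb
        (measurableEmbedding_addRight _) (fun ξ => u (ξ + (2 * Real.pi) • latticePt (-n))) S₀
    rw [← this]
    simp [latticePt_neg, A]
  simp_rw [h1]
  refine ((Equiv.neg (Fin 2 → ℤ)).tsum_eq
    (fun n => ∫⁻ ξ in S₀, u (ξ + (2 * Real.pi) • latticePt n))).trans ?_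
  exact (lintegral_tsum (μ := volume.restrict S₀)
    (f := fun n ξ => u (ξ + (2 * Real.pi) • latticePt n))
    fun n => (hu.comp (by fun_prop : Measurable fun ξ : Plane =>
      ξ + (2 * Real.pi) • latticePt n)).aemeasurable).symm

/-! ### Halving the lattice: parity classes and the shifts in `Γ` -/

/-- The shifts in `Γ`, indexed by binary vectors. -/
noncomputable def halfShift (ε : Fin 2 → Fin 2) : Plane :=
  WithLp.toLp 2 fun i => Real.pi * ((ε i : ℕ) : ℝ)

lemma halfShift_injective : Function.Injective halfShift := by
  intro a b h
  funext i
  have := congrArg (fun v : Plane => v i) h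
  simp only [halfShift] at this
  have h2 := mul_left_cancel₀ Real.pi_ne_zero this
  exact Fin.ext (by exact_mod_cast h2)

lemma sum_Γ {R : Type*} [AddCommMonoid R] (f : Plane → R) :
    ∑ γ ∈ Γ, f γ = ∑ ε : Fin 2 → Fin 2, f (halfShift ε) := by
  have : Γ = Finset.univ.image halfShift := by
    ext γ
    have h1 : ∀ ε : Fin 2 → Fin 2, halfShift ε =
        !₂[Real.pi * ((ε 0 : ℕ) : ℝ), Real.pi * ((ε 1 : ℕ) : ℝ)] := by
      intro ε; ext i; fin_cases i <;> simp [halfShift]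
    simp only [Γ, Finset.mem_insert, Finset.mem_singleton, Finset.mem_image, Finset.mem_univ,
      true_and, h1]
    constructor
    · rintro (rfl | rfl | rfl | rfl)
      · exact ⟨![0, 0], by simp⟩
      · exact ⟨![0, 1], by simp⟩
      · exact ⟨![1, 0], by simp⟩
      · exact ⟨![1, 1], by simp⟩
    · rintro ⟨ε, rfl⟩
      generalize ε 0 = a
      generalize ε 1 = b
      fin_cases a <;> fin_cases b <;> simp
  rw [this, Finset.sum_image fun a _ b _ h => halfShift_injective h]

/-- Splitting an integer vector into its half and its parity. -/
def parityEquiv : (Fin 2 → ℤ) ≃ (Fin 2 → ℤ) × (Fin 2 → Fin 2) :=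
  (Equiv.piCongrRight fun _ => Int.divModEquiv 2).trans (Equiv.arrowProdEquivProdArrow _ _ _)

lemma pi_smul_latticePt_parityEquiv_symm (m : Fin 2 → ℤ) (ε : Fin 2 → Fin 2) :
    Real.pi • latticePt (parityEquiv.symm (m, ε)) =
      halfShift ε + (2 * Real.pi) • latticePt m := by
  ext i
  have : parityEquiv.symm (m, ε) i = (ε i : ℕ) + m i * 2 := by
    simp [parityEquiv, Equiv.arrowProdEquivProdArrow, Int.divModEquiv, add_comm]
  simp only [PiLp.smul_apply, PiLp.add_apply, latticePt_apply, this, halfShift, smul_eq_mul]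
  push_cast
  ring

/-- The periodisation of `w(ξ/2) u(ξ/2)` in terms of that of `u`. -/
lemma periodize_refine {u w : Plane → ℝ≥0∞}
    (hw : ∀ ξ (n : Fin 2 → ℤ), w (ξ + (2 * Real.pi) • latticePt n) = w ξ) (ξ : Plane) :
    periodize (fun η => w ((2⁻¹ : ℝ) • η) * u ((2⁻¹ : ℝ) • η)) ξ =
      ∑ γ ∈ Γ, w ((2⁻¹ : ℝ) • ξ + γ) * periodize u ((2⁻¹ : ℝ) • ξ + γ) := by
  rw [sum_Γ (fun γ => w ((2⁻¹ : ℝ) • ξ + γ) * periodize u ((2⁻¹ : ℝ) • ξ + γ))]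
  have h1 : ∀ n : Fin 2 → ℤ, (2⁻¹ : ℝ) • (ξ + (2 * Real.pi) • latticePt n) =
      (2⁻¹ : ℝ) • ξ + Real.pi • latticePt n := by
    intro n; rw [smul_add, smul_smul]; congr 2; ring
  simp only [periodize, h1]
  -- Writing n = 2m + ε turns the translate πn into an element of `Γ` plus a period 2πm, and the
  -- periodic weight leaves the sum over m.
  rw [← parityEquiv.symm.tsum_eq, ENNReal.tsum_prod (f := fun m ε =>
    w ((2⁻¹ : ℝ) • ξ + Real.pi • latticePt (parityEquiv.symm (m, ε))) *
      u ((2⁻¹ : ℝ) • ξ + Real.pi • latticePt (parityEquiv.symm (m, ε)))),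
    ENNReal.tsum_comm, tsum_fintype]
  refine Finset.sum_congr rfl fun ε _ => ?_
  rw [← ENNReal.tsum_mul_left]
  refine tsum_congr fun m => ?_
  rw [pi_smul_latticePt_parityEquiv_symm, ← add_assoc, hw]

/-! ### Dyadic dilations and trigonometric polynomials -/

lemma dilInv_succ (k : ℕ) (ξ : Plane) : dilInv (k + 1) ξ = dilInv k ((2⁻¹ : ℝ) • ξ) := by
  rw [dilInv, dilInv, smul_smul, pow_succ, mul_inv]

lemma dilInv_zero_left (ξ : Plane) : dilInv 0 ξ = ξ := by simp [dilInv]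

lemma dilInv_one (ξ : Plane) : dilInv 1 ξ = (2⁻¹ : ℝ) • ξ := by simp [dilInv]

lemma dilInv_dilInv (j k : ℕ) (ξ : Plane) : dilInv j (dilInv k ξ) = dilInv (j + k) ξ := by
  rw [dilInv, dilInv, dilInv, smul_smul, pow_add, mul_inv]

lemma dilInv_zero_right (k : ℕ) : dilInv k 0 = 0 := by simp [dilInv]

lemma continuous_dilInv (k : ℕ) : Continuous (dilInv k) := by
  unfold dilInv; fun_prop

lemma norm_dilInv (k : ℕ) (ξ : Plane) : ‖dilInv k ξ‖ = (1 / 2) ^ k * ‖ξ‖ := by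
  rw [dilInv, norm_smul, norm_inv, norm_pow, Real.norm_ofNat, one_div, inv_pow]

lemma tendsto_dilInv (ξ : Plane) : Tendsto (fun k => dilInv k ξ) atTop (𝓝 0) := by
  rw [tendsto_zero_iff_norm_tendsto_zero]
  simp_rw [norm_dilInv]
  have := (tendsto_pow_atTop_nhds_zero_of_lt_one (r := (1 / 2 : ℝ)) (by norm_num)
    (by norm_num)).mul_const ‖ξ‖
  simpa using this

namespace IsTrigPoly

variable {M : Plane → ℂ}

lemma continuous (hM : IsTrigPoly M) : Continuous M := by
  obtain ⟨c, hc⟩ := hM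
  rw [show M = _ from funext hc]
  fun_prop

lemma periodic (hM : IsTrigPoly M) (ξ : Plane) (n : Fin 2 → ℤ) :
    M (ξ + (2 * Real.pi) • latticePt n) = M ξ := by
  obtain ⟨c, hc⟩ := hM
  rw [hc, hc]
  refine Finset.sum_congr rfl fun m _ => ?_
  congr 1
  rw [Complex.exp_eq_exp_iff_exists_int]
  refine ⟨-(m 0 * n 0 + m 1 * n 1), ?_⟩
  rw [inner_add_right, inner_smul_right]
  have : (inner ℝ (latticePt m) (latticePt n) : ℝ) = m 0 * n 0 + m 1 * n 1 := by
    simp [PiLp.inner_apply, latticePt_apply, Fin.sum_univ_two, mul_comm]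
  rw [this]
  push_cast
  ring

/-- Termwise, |exp(-ia) - exp(-ib)| ≤ |a - b| after a unimodular factor is removed, followed by
Cauchy–Schwarz. The constant controls both the convergence of the product and the transfer iterates.
-/
lemma exists_lipschitz (hM : IsTrigPoly M) :
    ∃ L : ℝ, 0 ≤ L ∧ ∀ ξ η, ‖M ξ - M η‖ ≤ L * ‖ξ - η‖ := by
  obtain ⟨c, hc⟩ := hM
  refine ⟨∑ n ∈ c.support, ‖c n‖ * ‖latticePt n‖, by positivity, fun ξ η => ?_⟩
  rw [hc ξ, hc η, ← Finset.sum_sub_distrib, Finset.sum_mul]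
  refine (norm_sum_le _ _).trans (Finset.sum_le_sum fun n _ => ?_)
  rw [← mul_sub, norm_mul, mul_assoc]
  refine mul_le_mul_of_nonneg_left ?_ (norm_nonneg _)
  set a : ℝ := inner ℝ (latticePt n) ξ
  set b : ℝ := inner ℝ (latticePt n) η
  have h1 : Complex.exp (-Complex.I * a) - Complex.exp (-Complex.I * b) =
      Complex.exp (Complex.I * ((-b : ℝ) : ℂ)) *
        (Complex.exp (Complex.I * ((-(a - b) : ℝ) : ℂ)) - 1) := by
    rw [mul_sub, ← Complex.exp_add, mul_one]
    congr 2 <;> push_cast <;> ring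
  rw [h1, norm_mul, mul_comm Complex.I, Complex.norm_exp_ofReal_mul_I, one_mul]
  refine Real.norm_exp_I_mul_ofReal_sub_one_le.trans ?_
  rw [norm_neg, ← inner_sub_right]
  exact norm_inner_le_norm _ _

end IsTrigPoly

/-! ### The infinite product: refinement, continuity and zeros -/

/-- The infinite product `∏_{k ≥ 1} M (D₂⁻ᵏ ξ)`. -/
noncomputable def refProd (M : Plane → ℂ) (ξ : Plane) : ℂ := ∏' k : ℕ, M (dilInv (k + 1) ξ)

section RefProd

variable {M : Plane → ℂ}

lemma refProd_zero (h0 : M 0 = 1) : refProd M 0 = 1 := by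
  simp [refProd, dilInv_zero_right, h0]

lemma refProd_eq_mul (hM : IsTrigPoly M) (h0 : M 0 = 1) (ξ : Plane) :
    refProd M ξ = M ((2⁻¹ : ℝ) • ξ) * refProd M ((2⁻¹ : ℝ) • ξ) := by
  have h1 : Multipliable fun k : ℕ => M (dilInv (k + 1 + 1) ξ) :=
    (multipliable_dilInv hM h0 ((2⁻¹ : ℝ) • ξ)).congr fun k => by rw [dilInv_succ (k + 1) ξ]
  have h2 := tprod_eq_zero_mul' (f := fun k : ℕ => M (dilInv (k + 1) ξ)) h1
  rw [refProd, h2, zero_add, dilInv_one, refProd]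
  congr 1
  exact tprod_congr fun k => by rw [dilInv_succ (k + 1) ξ]

lemma refProd_eq_prod_mul (hM : IsTrigPoly M) (h0 : M 0 = 1) (N : ℕ) (ξ : Plane) :
    refProd M ξ = (∏ k ∈ Finset.range N, M (dilInv (k + 1) ξ)) * refProd M (dilInv N ξ) := by
  induction N with
  | zero => simp [dilInv_zero_left]
  | succ N ih =>
    rw [ih, Finset.prod_range_succ, refProd_eq_mul hM h0 (dilInv N ξ), mul_assoc, ← dilInv_one,
      dilInv_dilInv, add_comm 1 N]

/-- Weierstrass test on balls: for ‖ξ‖ ≤ R the Lipschitz bound at 0 makes the k-th factor differ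
from 1 by at most L R 2^(-k-1), so the product converges uniformly. -/
lemma continuous_refProd (hM : IsTrigPoly M) (h0 : M 0 = 1) : Continuous (refProd M) := by
  obtain ⟨L, hL, hLip⟩ := hM.exists_lipschitz
  rw [continuous_iff_continuousAt]
  intro ξ₀
  set R := ‖ξ₀‖ + 1
  set K := Metric.closedBall (0 : Plane) R
  have hu : Summable fun k : ℕ => L * R * (1 / 2) ^ (k + 1) :=
    ((summable_nat_add_iff 1).2 summable_geometric_two).mul_left _
  have hcont : ∀ k : ℕ, Continuous fun ξ => M (dilInv (k + 1) ξ) - 1 := fun k =>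
    (hM.continuous.comp (continuous_dilInv _)).sub continuous_const
  have := Summable.hasProdUniformlyOn_nat_one_add (K := K)
    (f := fun (k : ℕ) ξ => M (dilInv (k + 1) ξ) - 1) (isCompact_closedBall _ _) hu ?_
    fun k => (hcont k).continuousOn
  · have hc := this.tendstoUniformlyOn.continuousOn (Frequently.of_forall fun s =>
      (continuous_finsetProd s fun k _ => (continuous_const.add (hcont k))).continuousOn)
    simp only [add_sub_cancel] at hc
    refine hc.continuousAt (Metric.closedBall_mem_nhds_of_mem ?_)
    simp [R]
  · refine Eventually.of_forall fun k ξ hξ => ?_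
    rw [← h0]
    refine (hLip _ _).trans ?_
    rw [sub_zero, norm_dilInv, mul_assoc]
    have : ‖ξ‖ ≤ R := by simpa [K] using hξ
    have h2 : (1 / 2 : ℝ) ^ (k + 1) * ‖ξ‖ ≤ R * (1 / 2) ^ (k + 1) := by
      rw [mul_comm]; gcongr
    exact mul_le_mul_of_nonneg_left h2 hL

/-- The tail of the product after N factors is its value at 2⁻ᴺξ, which tends to 1 by continuity;
only a vanishing factor can therefore make the product vanish. -/
lemma refProd_ne_zero_iff (hM : IsTrigPoly M) (h0 : M 0 = 1) (ξ : Plane) :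
    refProd M ξ ≠ 0 ↔ ∀ k : ℕ, M (dilInv (k + 1) ξ) ≠ 0 := by
  constructor
  · intro h k hk
    apply h
    rw [refProd_eq_prod_mul hM h0 (k + 1), Finset.prod_range_succ, hk, mul_zero, zero_mul]
  · intro h
    have h1 : Tendsto (fun N => refProd M (dilInv N ξ)) atTop (𝓝 1) := by
      rw [← refProd_zero h0]
      exact ((continuous_refProd hM h0).tendsto 0).comp (tendsto_dilInv ξ)
    obtain ⟨N, hN⟩ := (h1.eventually_ne one_ne_zero).exists
    rw [refProd_eq_prod_mul hM h0 N]
    exact mul_ne_zero (Finset.prod_ne_zero_iff.2 fun k _ => h k) hN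

end RefProd

/-! ### The mirror filter identity and a periodic Lipschitz bump -/

/-- The quadrature mirror filter identity. -/
def IsQMF (M : Plane → ℂ) : Prop := ∀ ξ : Plane, ∑ γ ∈ Γ, ‖M (ξ + γ)‖ ^ 2 = 1

lemma zero_mem_Γ : (0 : Plane) ∈ Γ := by
  have : (0 : Plane) = !₂[0, 0] := by ext i; fin_cases i <;> rfl
  rw [this]
  simp [Γ]

lemma IsQMF.norm_le_one {M : Plane → ℂ} (h : IsQMF M) (ξ : Plane) : ‖M ξ‖ ≤ 1 := by
  have h1 := h ξ
  have h2 := Finset.single_le_sum (f := fun γ => ‖M (ξ + γ)‖ ^ 2)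
    (fun γ _ => by positivity) zero_mem_Γ
  rw [h1, add_zero] at h2
  exact (sq_le_one_iff₀ (norm_nonneg _)).1 h2

lemma IsQMF.abs_sq_sub_sq_le {M : Plane → ℂ} (h : IsQMF M) {L : ℝ}
    (hL : ∀ ξ η, ‖M ξ - M η‖ ≤ L * ‖ξ - η‖) (ξ η : Plane) :
    |‖M ξ‖ ^ 2 - ‖M η‖ ^ 2| ≤ 2 * L * ‖ξ - η‖ := by
  rw [sq_sub_sq, abs_mul, mul_assoc]
  refine mul_le_mul ?_ ((abs_norm_sub_norm_le _ _).trans (hL ξ η)) (abs_nonneg _) (by norm_num)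
  rw [abs_of_nonneg (by positivity)]
  linarith [h.norm_le_one ξ, h.norm_le_one η]

/-- A `2πℤ²`-periodic Lipschitz bump at the origin. -/
noncomputable def bump (A : ℝ) (ξ : Plane) : ℝ := max (1 - A * ∑ i, |Real.sin (ξ i / 2)|) 0

lemma bump_nonneg (A : ℝ) (ξ : Plane) : 0 ≤ bump A ξ := le_max_right _ _

lemma bump_le_one {A : ℝ} (hA : 0 ≤ A) (ξ : Plane) : bump A ξ ≤ 1 := by
  refine max_le ?_ zero_le_one
  have : 0 ≤ A * ∑ i, |Real.sin (ξ i / 2)| := by positivity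
  linarith

lemma bump_zero (A : ℝ) : bump A 0 = 1 := by simp [bump]

lemma bump_periodic (A : ℝ) (ξ : Plane) (n : Fin 2 → ℤ) :
    bump A (ξ + (2 * Real.pi) • latticePt n) = bump A ξ := by
  have : ∀ i, |Real.sin ((ξ + (2 * Real.pi) • latticePt n) i / 2)| = |Real.sin (ξ i / 2)| := by
    intro i
    have h1 : (ξ + (2 * Real.pi) • latticePt n) i / 2 = ξ i / 2 + n i * Real.pi := by
      simp only [PiLp.add_apply, PiLp.smul_apply, latticePt_apply, smul_eq_mul]; ring
    rw [h1, Real.sin_add_int_mul_pi, abs_mul, abs_zpow, abs_neg, abs_one, one_zpow, one_mul]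
  simp only [bump, this]

lemma abs_bump_sub_le {A : ℝ} (hA : 0 ≤ A) (ξ η : Plane) :
    |bump A ξ - bump A η| ≤ A * ‖ξ - η‖ := by
  refine (abs_max_sub_max_le_abs _ _ _).trans ?_
  have h1 : 1 - A * ∑ i, |Real.sin (ξ i / 2)| - (1 - A * ∑ i, |Real.sin (η i / 2)|) =
      A * ∑ i, (|Real.sin (η i / 2)| - |Real.sin (ξ i / 2)|) := by
    rw [Finset.sum_sub_distrib]; ring
  rw [h1, abs_mul, abs_of_nonneg hA]
  refine mul_le_mul_of_nonneg_left ?_ hA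
  have h2 : ∀ i, |(|Real.sin (η i / 2)| - |Real.sin (ξ i / 2)|)| ≤ ‖ξ - η‖ / 2 := by
    intro i
    refine (abs_abs_sub_abs_le _ _).trans ((Real.abs_sin_sub_sin_le _ _).trans ?_)
    rw [← sub_div, abs_div, abs_two, abs_sub_comm]
    have := PiLp.norm_apply_le (ξ - η) i
    simp only [PiLp.sub_apply, Real.norm_eq_abs] at this
    linarith
  refine (Finset.abs_sum_le_sum_abs _ _).trans ((Finset.sum_le_sum fun i _ => h2 i).trans ?_)
  rw [Fin.sum_univ_two, add_halves]

lemma continuous_bump (A : ℝ) : Continuous (bump A) := by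
  unfold bump; fun_prop

lemma norm_le_sum_abs (ξ : Plane) : ‖ξ‖ ≤ ∑ i, |ξ i| := by
  rw [EuclideanSpace.norm_eq]
  refine Real.sqrt_le_iff.2 ⟨by positivity, ?_⟩
  simp only [Fin.sum_univ_two, Real.norm_eq_abs]
  nlinarith [abs_nonneg (ξ 0), abs_nonneg (ξ 1)]

/-- Jordan's inequality |sin t| ≥ 2|t|/π for |t| ≤ π/2, at t = ξᵢ/2, gives |ξᵢ|/π ≤ |sin(ξᵢ/2)| on
the square; this dictates the slope π/δ. -/
lemma norm_lt_of_bump_ne_zero {δ : ℝ} (hδ : 0 < δ) {ξ : Plane} (hξ : ξ ∈ S₀)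
    (h : bump (Real.pi / δ) ξ ≠ 0) : ‖ξ‖ < δ := by
  have h1 : 0 < 1 - Real.pi / δ * ∑ i, |Real.sin (ξ i / 2)| := by
    by_contra hc
    exact h (max_eq_right (not_lt.1 hc))
  have h2 : ∀ i, |ξ i| / Real.pi ≤ |Real.sin (ξ i / 2)| := by
    intro i
    have h3 : |ξ i| ≤ Real.pi := abs_le.2 ⟨(hξ i).1, (hξ i).2.le⟩
    have h4 : |ξ i / 2| ≤ Real.pi / 2 := by rw [abs_div, abs_two]; linarith
    have := Real.mul_abs_le_abs_sin h4
    rw [abs_div, abs_two] at this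
    refine le_trans (le_of_eq ?_) this
    ring
  have h5 : (∑ i, |ξ i|) / Real.pi ≤ ∑ i, |Real.sin (ξ i / 2)| := by
    rw [Finset.sum_div]; exact Finset.sum_le_sum fun i _ => h2 i
  refine (norm_le_sum_abs ξ).trans_lt ?_
  have h6 : Real.pi / δ * ((∑ i, |ξ i|) / Real.pi) < 1 := by
    have := mul_le_mul_of_nonneg_left h5 (div_pos Real.pi_pos hδ).le
    linarith
  have h7 : Real.pi / δ * ((∑ i, |ξ i|) / Real.pi) = (∑ i, |ξ i|) / δ := by
    field_simp
  rwa [h7, div_lt_one hδ] at h6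

lemma S₀_mem_nhds_zero : S₀ ∈ 𝓝 (0 : Plane) := by
  have : S₀ = ⋂ i, (fun ξ : Plane => ξ i) ⁻¹' Set.Ico (-Real.pi) Real.pi := by
    ext; simp [S₀]
  rw [this, Filter.iInter_mem]
  intro i
  refine ContinuousAt.preimage_mem_nhds (by fun_prop) (Ico_mem_nhds ?_ ?_) <;>
    simp [Real.pi_pos]

/-! ### The transfer operator -/

/-- The transfer operator of the mask `M`. -/
noncomputable def transfer (M : Plane → ℂ) (r : Plane → ℝ) (ξ : Plane) : ℝ :=
  ∑ γ ∈ Γ, ‖M ((2⁻¹ : ℝ) • ξ + γ)‖ ^ 2 * r ((2⁻¹ : ℝ) • ξ + γ)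

section Transfer

variable {M : Plane → ℂ}

lemma transfer_nonneg {r : Plane → ℝ} (hr : ∀ ξ, 0 ≤ r ξ) (ξ : Plane) : 0 ≤ transfer M r ξ :=
  Finset.sum_nonneg fun γ _ => mul_nonneg (by positivity) (hr _)

lemma IsQMF.transfer_le_one (h : IsQMF M) {r : Plane → ℝ} (hr : ∀ ξ, r ξ ≤ 1) (ξ : Plane) :
    transfer M r ξ ≤ 1 := by
  rw [← h ((2⁻¹ : ℝ) • ξ)]
  exact Finset.sum_le_sum fun γ _ => mul_le_of_le_one_right (by positivity) (hr _)

/-- The transfer operator contracts Lipschitz constants up to an additive constant. -/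
lemma IsQMF.abs_transfer_sub_le (h : IsQMF M) {L : ℝ}
    (hL : ∀ ξ η, ‖M ξ - M η‖ ≤ L * ‖ξ - η‖) {r : Plane → ℝ} {C : ℝ} (hC : 8 * L ≤ C)
    (hr0 : ∀ ξ, 0 ≤ r ξ) (hr1 : ∀ ξ, r ξ ≤ 1) (hr : ∀ ξ η, |r ξ - r η| ≤ C * ‖ξ - η‖)
    (ξ η : Plane) : |transfer M r ξ - transfer M r η| ≤ C * ‖ξ - η‖ := by
  set x := (2⁻¹ : ℝ) • ξ
  set y := (2⁻¹ : ℝ) • η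
  have hd : ∀ γ : Plane, ‖(x + γ) - (y + γ)‖ = ‖ξ - η‖ / 2 := by
    intro γ
    rw [add_sub_add_right_eq_sub, ← smul_sub, norm_smul]
    norm_num
    ring
  have key : ∀ γ ∈ Γ, |‖M (x + γ)‖ ^ 2 * r (x + γ) - ‖M (y + γ)‖ ^ 2 * r (y + γ)| ≤
      ‖M (x + γ)‖ ^ 2 * (C * (‖ξ - η‖ / 2)) + 2 * L * (‖ξ - η‖ / 2) := by
    intro γ _
    have h1 := hr (x + γ) (y + γ)
    have h2 := h.abs_sq_sub_sq_le hL (x + γ) (y + γ)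
    rw [hd] at h1 h2
    have h3 : ‖M (x + γ)‖ ^ 2 * r (x + γ) - ‖M (y + γ)‖ ^ 2 * r (y + γ) =
        ‖M (x + γ)‖ ^ 2 * (r (x + γ) - r (y + γ)) +
          (‖M (x + γ)‖ ^ 2 - ‖M (y + γ)‖ ^ 2) * r (y + γ) := by ring
    rw [h3]
    refine (abs_add_le _ _).trans (add_le_add ?_ ?_)
    · rw [abs_mul, abs_of_nonneg (by positivity : 0 ≤ ‖M (x + γ)‖ ^ 2)]
      exact mul_le_mul_of_nonneg_left h1 (by positivity)
    · rw [abs_mul, abs_of_nonneg (hr0 _)]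
      exact (mul_le_of_le_one_right (abs_nonneg _) (hr1 _)).trans h2
  rw [transfer, transfer, ← Finset.sum_sub_distrib]
  refine (Finset.abs_sum_le_sum_abs _ _).trans ((Finset.sum_le_sum key).trans ?_)
  -- The weights sum to 1, so the first terms give C/2 times ‖ξ - η‖. The four remaining terms give
  -- 4L times it, which is at most the other half because 8L ≤ C.
  rw [Finset.sum_add_distrib, ← Finset.sum_mul, h x, sum_Γ (fun _ => 2 * L * (‖ξ - η‖ / 2))]
  simp only [Finset.sum_const, Finset.card_univ, Fintype.card_pi, Fintype.card_fin,
    Finset.prod_const, nsmul_eq_mul]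
  have := mul_le_mul_of_nonneg_right hC (norm_nonneg (ξ - η))
  push_cast
  nlinarith

end Transfer

/-! ### The periodised density: bound, continuity and the value 1 -/

/-- The density `|∏_{k ≥ 1} M (D₂⁻ᵏ ξ)|²`. -/
noncomputable def specDensity (M : Plane → ℂ) (ξ : Plane) : ℝ≥0∞ :=
  ENNReal.ofReal (‖refProd M ξ‖ ^ 2)

/-- The truncated density `∏_{k ≤ N} |M (D₂⁻ᵏ ξ)|²` cut off by a bump on the dilated square. -/
noncomputable def truncDensity (M : Plane → ℂ) (A : ℝ) (N : ℕ) (ξ : Plane) : ℝ :=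
  ‖∏ k ∈ Finset.range N, M (dilInv (k + 1) ξ)‖ ^ 2 * S₀.indicator (bump A) (dilInv N ξ)

section

variable {M : Plane → ℂ}

lemma IsTrigPoly.ofReal_periodic (hM : IsTrigPoly M) (ξ : Plane) (n : Fin 2 → ℤ) :
    ENNReal.ofReal (‖M (ξ + (2 * Real.pi) • latticePt n)‖ ^ 2) = ENNReal.ofReal (‖M ξ‖ ^ 2) := by
  rw [hM.periodic]

lemma measurable_specDensity (hM : IsTrigPoly M) (h0 : M 0 = 1) : Measurable (specDensity M) := by
  have := (continuous_refProd hM h0).measurable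
  unfold specDensity
  fun_prop

lemma specDensity_eq_mul (hM : IsTrigPoly M) (h0 : M 0 = 1) (ξ : Plane) :
    specDensity M ξ =
      ENNReal.ofReal (‖M ((2⁻¹ : ℝ) • ξ)‖ ^ 2) * specDensity M ((2⁻¹ : ℝ) • ξ) := by
  rw [specDensity, refProd_eq_mul hM h0, norm_mul, mul_pow, ENNReal.ofReal_mul (by positivity),
    specDensity]

/-- The refinement equation for the periodised density. -/
lemma periodize_specDensity_eq (hM : IsTrigPoly M) (h0 : M 0 = 1) (ξ : Plane) :
    periodize (specDensity M) ξ = ∑ γ ∈ Γ, ENNReal.ofReal (‖M ((2⁻¹ : ℝ) • ξ + γ)‖ ^ 2) *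
      periodize (specDensity M) ((2⁻¹ : ℝ) • ξ + γ) := by
  rw [← periodize_refine (w := fun η => ENNReal.ofReal (‖M η‖ ^ 2)) hM.ofReal_periodic ξ]
  exact congrArg (fun u => periodize u ξ) (funext fun η => specDensity_eq_mul hM h0 η)

lemma truncDensity_nonneg (A : ℝ) (N : ℕ) (ξ : Plane) : 0 ≤ truncDensity M A N ξ :=
  mul_nonneg (by positivity) (Set.indicator_nonneg (fun _ _ => bump_nonneg _ _) _)

lemma truncDensity_succ (A : ℝ) (N : ℕ) (ξ : Plane) :
    truncDensity M A (N + 1) ξ =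
      ‖M ((2⁻¹ : ℝ) • ξ)‖ ^ 2 * truncDensity M A N ((2⁻¹ : ℝ) • ξ) := by
  simp only [truncDensity, Finset.prod_range_succ', dilInv_succ _ ξ, norm_mul, mul_pow,
    dilInv_zero_left]
  ring

/-- At N = 0 the cutoff to the square periodises back to the bump; each further factor of the
product then amounts to one application of the transfer operator. -/
lemma periodize_truncDensity (hM : IsTrigPoly M) {A : ℝ} (N : ℕ) (ξ : Plane) :
    periodize (fun η => ENNReal.ofReal (truncDensity M A N η)) ξ =
      ENNReal.ofReal ((transfer M)^[N] (bump A) ξ) := by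
  induction N generalizing ξ with
  | zero =>
    have h1 : (fun η => ENNReal.ofReal (truncDensity M A 0 η)) =
        S₀.indicator fun η => ENNReal.ofReal (bump A η) := by
      funext η
      by_cases hη : η ∈ S₀ <;> simp [truncDensity, dilInv_zero_left, hη]
    rw [h1, periodize_indicator_S₀ fun η n => by rw [bump_periodic]]
    rfl
  | succ N ih =>
    have h1 : (fun η => ENNReal.ofReal (truncDensity M A (N + 1) η)) =
        fun η => ENNReal.ofReal (‖M ((2⁻¹ : ℝ) • η)‖ ^ 2) *
          ENNReal.ofReal (truncDensity M A N ((2⁻¹ : ℝ) • η)) := by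
      funext η
      rw [truncDensity_succ, ENNReal.ofReal_mul (by positivity)]
    have hr : ∀ n ξ, 0 ≤ (transfer M)^[n] (bump A) ξ := by
      intro n
      induction n with
      | zero => exact bump_nonneg A
      | succ n ih => rw [Function.iterate_succ_apply']; exact transfer_nonneg ih
    rw [h1, periodize_refine (w := fun η => ENNReal.ofReal (‖M η‖ ^ 2)) (u := fun η => ENNReal.ofReal (truncDensity M A N η))
      hM.ofReal_periodic, Function.iterate_succ_apply', transfer,
      ENNReal.ofReal_sum_of_nonneg fun γ _ => mul_nonneg (by positivity) (hr N _)]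
    refine Finset.sum_congr rfl fun γ _ => ?_
    rw [ih, ENNReal.ofReal_mul (by positivity)]

lemma IsQMF.iterate_transfer_bounds (h : IsQMF M) {A : ℝ} (hA : 0 ≤ A) (N : ℕ) (ξ : Plane) :
    0 ≤ (transfer M)^[N] (bump A) ξ ∧ (transfer M)^[N] (bump A) ξ ≤ 1 := by
  induction N generalizing ξ with
  | zero => exact ⟨bump_nonneg A ξ, bump_le_one hA ξ⟩
  | succ N ih =>
    rw [Function.iterate_succ_apply']
    exact ⟨transfer_nonneg (fun η => (ih η).1) ξ, h.transfer_le_one (fun η => (ih η).2) ξ⟩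

lemma IsQMF.abs_iterate_transfer_sub_le (h : IsQMF M) {L : ℝ}
    (hL : ∀ ξ η, ‖M ξ - M η‖ ≤ L * ‖ξ - η‖) {A : ℝ} (hA : 0 ≤ A) (N : ℕ) (ξ η : Plane) :
    |(transfer M)^[N] (bump A) ξ - (transfer M)^[N] (bump A) η| ≤ max A (8 * L) * ‖ξ - η‖ := by
  induction N generalizing ξ η with
  | zero =>
    exact (abs_bump_sub_le hA ξ η).trans
      (mul_le_mul_of_nonneg_right (le_max_left _ _) (norm_nonneg _))
  | succ N ih =>
    simp only [Function.iterate_succ_apply']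
    exact h.abs_transfer_sub_le hL (le_max_right _ _)
      (fun ζ => (h.iterate_transfer_bounds hA N ζ).1)
      (fun ζ => (h.iterate_transfer_bounds hA N ζ).2) ih ξ η

/-- The cutoff is evaluated at 2⁻ᴺξ, which tends to 0; there the square is a neighbourhood and the
bump equals 1. -/
lemma tendsto_truncDensity (hM : IsTrigPoly M) (h0 : M 0 = 1) (A : ℝ) (ξ : Plane) :
    Tendsto (fun N => truncDensity M A N ξ) atTop (𝓝 (‖refProd M ξ‖ ^ 2)) := by
  have h1 : Tendsto (fun N => ∏ k ∈ Finset.range N, M (dilInv (k + 1) ξ)) atTop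
      (𝓝 (refProd M ξ)) := (multipliable_dilInv hM h0 ξ).hasProd.tendsto_prod_nat
  have h2 : Tendsto (fun N => S₀.indicator (bump A) (dilInv N ξ)) atTop (𝓝 1) := by
    have h3 : Tendsto (fun N => bump A (dilInv N ξ)) atTop (𝓝 1) := by
      rw [← bump_zero A]
      exact ((continuous_bump A).tendsto 0).comp (tendsto_dilInv ξ)
    refine h3.congr' ?_
    filter_upwards [(tendsto_dilInv ξ).eventually_mem S₀_mem_nhds_zero] with N hN
    exact (Set.indicator_of_mem hN _).symm
  have h4 := (h1.norm.pow 2).mul h2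
  rw [mul_one] at h4
  exact h4

/-- If the bump is supported where the product is bounded below, the truncated densities are
dominated by the density itself. -/
lemma exists_truncDensity_le (hM : IsTrigPoly M) (h0 : M 0 = 1) :
    ∃ A : ℝ, 0 ≤ A ∧ ∀ N ξ, truncDensity M A N ξ ≤ 2 * ‖refProd M ξ‖ ^ 2 := by
  have h1 : ∀ᶠ ξ in 𝓝 (0 : Plane), 1 / 2 < ‖refProd M ξ‖ ^ 2 := by
    have hc : Continuous fun ξ => ‖refProd M ξ‖ ^ 2 := (continuous_refProd hM h0).norm.pow 2
    refine (hc.tendsto 0).eventually (lt_mem_nhds ?_)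
    rw [refProd_zero h0]
    norm_num
  obtain ⟨δ, hδ, hb⟩ := Metric.eventually_nhds_iff.1 h1
  -- With this slope the cutoff lives in the ball of radius δ, where the tail satisfies |P|² > 1/2;
  -- twice the tail then dominates the bump, whose values are at most 1.
  refine ⟨Real.pi / δ, (div_pos Real.pi_pos hδ).le, fun N ξ => ?_⟩
  have hA : (0 : ℝ) ≤ Real.pi / δ := (div_pos Real.pi_pos hδ).le
  rw [refProd_eq_prod_mul hM h0 N ξ, norm_mul, mul_pow, truncDensity, mul_left_comm]
  refine mul_le_mul_of_nonneg_left ?_ (by positivity)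
  by_cases hS : dilInv N ξ ∈ S₀
  · rw [Set.indicator_of_mem hS]
    by_cases hz : bump (Real.pi / δ) (dilInv N ξ) = 0
    · rw [hz]; positivity
    · have := hb (y := dilInv N ξ) (by
        rw [dist_zero_right]; exact norm_lt_of_bump_ne_zero hδ hS hz)
      linarith [bump_le_one hA (dilInv N ξ)]
  · rw [Set.indicator_of_notMem hS]; positivity

/-- A Fatou argument on finite partial sums. The slope 0 makes the bump constantly 1, as an upper
bound needs no domination. -/
lemma IsQMF.periodize_specDensity_le_one (h : IsQMF M) (hM : IsTrigPoly M) (h0 : M 0 = 1)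
    (ξ : Plane) : periodize (specDensity M) ξ ≤ 1 := by
  rw [periodize, ENNReal.tsum_eq_iSup_sum]
  refine iSup_le fun s => ?_
  have h1 : Tendsto (fun N => ∑ n ∈ s,
      ENNReal.ofReal (truncDensity M 0 N (ξ + (2 * Real.pi) • latticePt n))) atTop
      (𝓝 (∑ n ∈ s, specDensity M (ξ + (2 * Real.pi) • latticePt n))) :=
    tendsto_finsetSum s fun n _ => ENNReal.tendsto_ofReal (tendsto_truncDensity hM h0 0 _)
  refine le_of_tendsto h1 (Eventually.of_forall fun N => ?_)
  refine (ENNReal.sum_le_tsum s).trans ?_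
  have h2 := periodize_truncDensity hM (A := 0) N ξ
  rw [periodize] at h2
  rw [h2, ← ENNReal.ofReal_one]
  exact ENNReal.ofReal_le_ofReal (h.iterate_transfer_bounds le_rfl N ξ).2

/-- Under the quadrature mirror filter identity, the periodised density is continuous. -/
lemma IsQMF.continuous_periodize_specDensity (h : IsQMF M) (hM : IsTrigPoly M) (h0 : M 0 = 1) :
    Continuous fun ξ => (periodize (specDensity M) ξ).toReal := by
  obtain ⟨L, hL0, hL⟩ := hM.exists_lipschitz
  obtain ⟨A, hA, hdom⟩ := exists_truncDensity_le hM h0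
  have hfin : ∀ ξ, periodize (specDensity M) ξ ≠ ∞ := fun ξ =>
    ((h.periodize_specDensity_le_one hM h0 ξ).trans_lt ENNReal.one_lt_top).ne
  have hlim : ∀ ξ, Tendsto (fun N => (transfer M)^[N] (bump A) ξ) atTop
      (𝓝 (periodize (specDensity M) ξ).toReal) := by
    intro ξ
    have h1 : ∀ N, (transfer M)^[N] (bump A) ξ =
        ∑' n, truncDensity M A N (ξ + (2 * Real.pi) • latticePt n) := by
      intro N
      rw [← ENNReal.toReal_ofReal (h.iterate_transfer_bounds hA N ξ).1,
        ← periodize_truncDensity hM, periodize, ENNReal.tsum_toReal_eq fun _ => ENNReal.ofReal_ne_top]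
      exact tsum_congr fun n => ENNReal.toReal_ofReal (truncDensity_nonneg _ _ _)
    have h2 : (periodize (specDensity M) ξ).toReal =
        ∑' n, ‖refProd M (ξ + (2 * Real.pi) • latticePt n)‖ ^ 2 := by
      refine (ENNReal.tsum_toReal_eq fun _ => ENNReal.ofReal_ne_top).trans ?_
      exact tsum_congr fun n => ENNReal.toReal_ofReal (by positivity)
    have h3 : Summable fun n => 2 * ‖refProd M (ξ + (2 * Real.pi) • latticePt n)‖ ^ 2 := by
      refine Summable.mul_left 2 ((ENNReal.summable_toReal (hfin ξ)).congr fun n => ?_)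
      exact ENNReal.toReal_ofReal (by positivity)
    simp_rw [h1]
    rw [h2]
    -- The dominating series is twice F(ξ), already known to be finite.
    refine tendsto_tsum_of_dominated_convergence h3 (fun n => tendsto_truncDensity hM h0 A _)
      (Eventually.of_forall fun N n => ?_)
    rw [Real.norm_of_nonneg (truncDensity_nonneg _ _ _)]
    exact hdom N _
  -- The Lipschitz bound is uniform in N, so it passes to the pointwise limit.
  refine (LipschitzWith.of_dist_le_mul (K := (max A (8 * L)).toNNReal) fun ξ η => ?_).continuous
  rw [Real.dist_eq, dist_eq_norm, Real.coe_toNNReal _ (hA.trans (le_max_left _ _))]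
  exact le_of_tendsto ((hlim ξ).sub (hlim η)).abs
    (Eventually.of_forall fun N => h.abs_iterate_transfer_sub_le hL hA N ξ η)

/-- If every `2πℤ²`-orbit meets the set where the product does not vanish, then the periodised
density is identically `1`. -/
lemma IsQMF.periodize_specDensity_eq_one (h : IsQMF M) (hM : IsTrigPoly M) (h0 : M 0 = 1)
    (hne : ∀ ξ : Plane, ∃ n : Fin 2 → ℤ, refProd M (ξ + (2 * Real.pi) • latticePt n) ≠ 0)
    (ξ : Plane) : periodize (specDensity M) ξ = 1 := by
  set F : Plane → ℝ := fun ξ => (periodize (specDensity M) ξ).toReal with hF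
  have hfin : ∀ ξ, periodize (specDensity M) ξ ≠ ∞ := fun ξ =>
    ((h.periodize_specDensity_le_one hM h0 ξ).trans_lt ENNReal.one_lt_top).ne
  have hcont : Continuous F := h.continuous_periodize_specDensity hM h0
  have hper : ∀ ξ (n : Fin 2 → ℤ), F (ξ + (2 * Real.pi) • latticePt n) = F ξ := fun ξ n => by
    simp only [hF, periodize_add]
  have href : ∀ ξ, F ξ = transfer M F ξ := by
    intro ξ
    simp only [hF, transfer]
    rw [periodize_specDensity_eq hM h0, ENNReal.toReal_sum fun γ _ =>
      ENNReal.mul_ne_top ENNReal.ofReal_ne_top (hfin _)]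
    refine Finset.sum_congr rfl fun γ _ => ?_
    rw [ENNReal.toReal_mul, ENNReal.toReal_ofReal (by positivity)]
  obtain ⟨ξ₀, hmin⟩ : ∃ ξ₀, ∀ ξ, F ξ₀ ≤ F ξ := by
    -- The square is not compact; a closed ball containing it is, and periodicity makes the minimum
    -- there global.
    have hK : IsCompact (Metric.closedBall (0 : Plane) (2 * Real.pi)) := isCompact_closedBall _ _
    obtain ⟨ξ₀, -, hξ₀⟩ := hK.exists_isMinOn ⟨0, by simp [Real.pi_pos.le]⟩ hcont.continuousOn
    refine ⟨ξ₀, fun ξ => ?_⟩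
    obtain ⟨n, hn, -⟩ := existsUnique_add_mem_S₀ ξ
    rw [← hper ξ n]
    refine hξ₀ ?_
    rw [mem_closedBall_zero_iff]
    refine (norm_le_sum_abs _).trans ?_
    rw [Fin.sum_univ_two]
    have := abs_le.2 ⟨(hn 0).1, (hn 0).2.le⟩
    have := abs_le.2 ⟨(hn 1).1, (hn 1).2.le⟩
    linarith
  -- Minimum principle: F(ξ) is a weighted mean of values that are at least the minimum. If the mean
  -- attains it, so does each value with nonzero weight, in particular the one at γ = 0.
  have hback : ∀ ξ, F ξ = F ξ₀ → M ((2⁻¹ : ℝ) • ξ) ≠ 0 → F ((2⁻¹ : ℝ) • ξ) = F ξ₀ := by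
    intro ξ hξ hM0
    set x := (2⁻¹ : ℝ) • ξ
    have h1 : ∑ γ ∈ Γ, ‖M (x + γ)‖ ^ 2 * (F (x + γ) - F ξ₀) = 0 := by
      simp only [mul_sub]
      rw [Finset.sum_sub_distrib, ← Finset.sum_mul, h x, one_mul, ← hξ]
      exact sub_eq_zero.2 (href ξ).symm
    have h2 := (Finset.sum_eq_zero_iff_of_nonneg fun γ _ =>
      mul_nonneg (by positivity) (sub_nonneg.2 (hmin _))).1 h1 0 zero_mem_Γ
    rw [add_zero] at h2
    rcases mul_eq_zero.1 h2 with h3 | h3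
    · exact absurd (norm_eq_zero.1 (pow_eq_zero_iff two_ne_zero |>.1 h3)) hM0
    · exact sub_eq_zero.1 h3
  obtain ⟨n, hn⟩ := hne ξ₀
  set ξ₁ := ξ₀ + (2 * Real.pi) • latticePt n
  have hit : ∀ k, F (dilInv k ξ₁) = F ξ₀ := by
    intro k
    induction k with
    | zero => rw [dilInv_zero_left, hper]
    | succ k ih =>
      have h1 : dilInv (k + 1) ξ₁ = (2⁻¹ : ℝ) • dilInv k ξ₁ := by
        rw [← dilInv_one, dilInv_dilInv, add_comm]
      have h2 := (refProd_ne_zero_iff hM h0 ξ₁).1 hn k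
      rw [h1] at h2 ⊢
      exact hback _ ih h2
  have h4 : F 0 = F ξ₀ := by
    have h5 : Tendsto (fun k => F (dilInv k ξ₁)) atTop (𝓝 (F 0)) :=
      (hcont.tendsto 0).comp (tendsto_dilInv ξ₁)
    simp_rw [hit] at h5
    exact tendsto_nhds_unique h5 tendsto_const_nhds |>.symm ▸ rfl
  -- The term n = 0 alone contributes |P(0)|² = 1.
  have h6 : 1 ≤ periodize (specDensity M) 0 := by
    refine le_trans ?_ (le_periodize _ _)
    rw [specDensity, refProd_zero h0]; simp
  refine le_antisymm (h.periodize_specDensity_le_one hM h0 ξ) ?_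
  have h7 : 1 ≤ F ξ := by
    refine le_trans ?_ (hmin ξ)
    rw [← h4]
    exact (ENNReal.toReal_mono (hfin 0) h6).trans_eq' (by simp)
  rw [← ENNReal.ofReal_toReal (hfin ξ), ← ENNReal.ofReal_one]
  exact ENNReal.ofReal_le_ofReal h7

end

/-! ### Fourier transforms of shifts and of scaling functions -/

/-- The phase `exp(-2πi n·x)` by which the Fourier transform of a shift is multiplied. -/
noncomputable def phase (n : Fin 2 → ℤ) (x : Plane) : ℂ :=
  Complex.exp (-Complex.I * ((inner ℝ (latticePt n) ((2 * Real.pi) • x) : ℝ) : ℂ))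

lemma continuous_phase (n : Fin 2 → ℤ) : Continuous (phase n) := by
  unfold phase; fun_prop

lemma norm_phase (n : Fin 2 → ℤ) (x : Plane) : ‖phase n x‖ = 1 := by
  rw [phase, neg_mul, ← mul_neg, mul_comm, ← Complex.ofReal_neg, Complex.norm_exp_ofReal_mul_I]

lemma memLp_phase (n : Fin 2 → ℤ) : MemLp (phase n) ∞ (volume : Measure Plane) :=
  memLp_top_of_bound (continuous_phase n).aestronglyMeasurable 1
    (Eventually.of_forall fun x => (norm_phase n x).le)

/-- Multiplication by a phase, on `L²`. -/
noncomputable def phaseMul (n : Fin 2 → ℤ) :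
    Lp ℂ 2 (volume : Measure Plane) →L[ℂ] Lp ℂ 2 (volume : Measure Plane) :=
  (ContinuousLinearMap.mul ℂ ℂ).holderL volume ∞ 2 2 (memLp_phase n).toLp

lemma coeFn_phaseMul (n : Fin 2 → ℤ) (f : Lp ℂ 2 (volume : Measure Plane)) :
    phaseMul n f =ᵐ[volume] fun x => phase n x * f x := by
  have h := (ContinuousLinearMap.mul ℂ ℂ).coeFn_holder (r := 2) (memLp_phase n).toLp f
  filter_upwards [h, (memLp_phase n).coeFn_toLp] with x hx hx'
  rw [hx'] at hx
  exact hx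

lemma fourier_comp_sub_latticePt (n : Fin 2 → ℤ) (f : Plane → ℂ) (w : Plane) :
    𝓕 (fun x => f (x - latticePt n)) w = phase n w * 𝓕 f w := by
  rw [Real.fourier_eq, Real.fourier_eq, ← integral_const_mul,
    ← integral_add_right_eq_self _ (latticePt n)]
  refine integral_congr_ae (Eventually.of_forall fun x => ?_)
  simp only [add_sub_cancel_right, Circle.smul_def, Real.fourierChar_apply, smul_eq_mul, phase,
    ← mul_assoc, ← Complex.exp_add]
  congr 2
  rw [inner_add_left, inner_smul_right]
  push_cast
  ring

/-- The Fourier transform on `L²` turns shifts into phases. -/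
lemma fourier_shift (n : Fin 2 → ℤ) (f : Lp ℂ 2 (volume : Measure Plane)) :
    (𝓕 (shift n f) : Lp ℂ 2 (volume : Measure Plane)) = phaseMul n (𝓕 f) := by
  -- Both sides are continuous in f, so it suffices to check Schwartz functions, whose transform is
  -- given by the integral.
  refine DenseRange.induction_on
    (p := fun f : Lp ℂ 2 (volume : Measure Plane) =>
      (𝓕 (shift n f) : Lp ℂ 2 (volume : Measure Plane)) = phaseMul n (𝓕 f))
    (SchwartzMap.denseRange_toLpCLM (p := 2) ENNReal.ofNat_ne_top) f ?_ ?_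
  · refine isClosed_eq ?_ ?_
    · exact (Lp.fourierTransformₗᵢ Plane ℂ).continuous.comp
        (Lp.isometry_compMeasurePreserving _).continuous
    · exact (phaseMul n).continuous.comp (Lp.fourierTransformₗᵢ Plane ℂ).continuous
  · intro g
    have h1 : shift n (g.toLp 2) = (g.compSubConstCLM ℂ (latticePt n)).toLp 2 := by
      refine Lp.ext ?_
      refine (Lp.coeFn_compMeasurePreserving _
        (measurePreserving_sub_right volume (latticePt n))).trans ?_
      have h2 := (measurePreserving_sub_right (volume : Measure Plane)
        (latticePt n)).quasiMeasurePreserving.ae_eq_comp (SchwartzMap.coeFn_toLp g 2)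
      refine h2.trans ?_
      exact (SchwartzMap.coeFn_toLp (g.compSubConstCLM ℂ (latticePt n)) 2).symm
    change 𝓕 (shift n (g.toLp 2)) = phaseMul n (𝓕 (g.toLp 2))
    rw [h1, SchwartzMap.toLp_fourier_eq, SchwartzMap.toLp_fourier_eq]
    refine Lp.ext ?_
    filter_upwards [SchwartzMap.coeFn_toLp (𝓕 (g.compSubConstCLM ℂ (latticePt n))) 2,
      coeFn_phaseMul n ((𝓕 g).toLp 2), SchwartzMap.coeFn_toLp (𝓕 g) 2] with x h3 h4 h5
    rw [h3, h4, h5, SchwartzMap.fourier_coe, SchwartzMap.fourier_coe,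
      ← fourier_comp_sub_latticePt]
    rfl

/-- The characters of the frequency torus. -/
noncomputable def latticeChar (n : Fin 2 → ℤ) (ξ : Plane) : ℂ :=
  Complex.exp (Complex.I * ((inner ℝ (latticePt n) ξ : ℝ) : ℂ))

lemma conj_phase_mul_phase (m n : Fin 2 → ℤ) (x : Plane) :
    starRingEnd ℂ (phase m x) * phase n x = latticeChar (m - n) ((2 * Real.pi) • x) := by
  rw [phase, phase, ← Complex.exp_conj, ← Complex.exp_add, latticeChar, sub_eq_add_neg,
    latticePt_add, latticePt_neg, inner_add_left, inner_neg_left]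
  congr 1
  simp only [map_mul, map_neg, Complex.conj_I, Complex.conj_ofReal]
  push_cast
  ring

section ScalingFunction

variable {M : Plane → ℂ} {φ : Lp ℂ 2 (volume : Measure Plane)}

/-- The factors (2π)⁻¹ cancel, and dilation by 2π or its inverse preserves null sets. -/
lemma isScalingFunction_iff : IsScalingFunction M φ ↔
    ∀ᵐ x : Plane, (𝓕 φ : Lp ℂ 2 (volume : Measure Plane)) x = refProd M ((2 * Real.pi) • x) := by
  have hpi : (2 * Real.pi) ≠ 0 := Real.two_pi_pos.ne'
  have hc : ((2 * Real.pi : ℝ) : ℂ)⁻¹ ≠ 0 := inv_ne_zero (Complex.ofReal_ne_zero.2 hpi)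
  constructor
  · intro h
    have := (Measure.quasiMeasurePreserving_smul (volume : Measure Plane) hpi).ae h
    filter_upwards [this] with x hx
    simp only [fourierL2, phiHat] at hx
    rw [smul_smul, inv_mul_cancel₀ hpi, one_smul] at hx
    exact mul_left_cancel₀ hc hx
  · intro h
    have := (Measure.quasiMeasurePreserving_smul (volume : Measure Plane) (inv_ne_zero hpi)).ae h
    unfold IsScalingFunction
    filter_upwards [this] with x hx
    rw [smul_smul, mul_inv_cancel₀ hpi, one_smul] at hx
    rw [fourierL2, hx, phiHat, refProd]

/-- Inner products of shifts of a scaling function, in terms of the infinite product. -/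
lemma inner_shift_shift (h : IsScalingFunction M φ) (m n : Fin 2 → ℤ) :
    inner ℂ (shift m φ) (shift n φ) = (((2 * Real.pi) ^ 2)⁻¹ : ℝ) •
      ∫ ξ : Plane, (‖refProd M ξ‖ ^ 2) • latticeChar (m - n) ξ := by
  rw [← Lp.inner_fourier_eq, fourier_shift, fourier_shift, L2.inner_def]
  have h1 : ∫ x : Plane, inner ℂ (phaseMul m (𝓕 φ) x) (phaseMul n (𝓕 φ) x) =
      ∫ x : Plane, (fun ξ : Plane => (‖refProd M ξ‖ ^ 2) • latticeChar (m - n) ξ)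
        ((2 * Real.pi) • x) := by
    refine integral_congr_ae ?_
    filter_upwards [coeFn_phaseMul m (𝓕 φ), coeFn_phaseMul n (𝓕 φ),
      isScalingFunction_iff.1 h] with x h2 h3 h4
    rw [h2, h3, h4]
    simp only [RCLike.inner_apply, map_mul, ← conj_phase_mul_phase, Complex.real_smul]
    rw [Complex.ofReal_pow, ← Complex.conj_mul']
    ring
  -- The substitution ξ = 2πx in dimension 2 produces the factor (2π)⁻².
  rw [h1, Measure.integral_comp_smul volume
    (fun ξ : Plane => (‖refProd M ξ‖ ^ 2) • latticeChar (m - n) ξ) (2 * Real.pi),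
    finrank_euclideanSpace_fin, abs_of_nonneg (by positivity)]

lemma integrable_normSq_refProd (h : IsScalingFunction M φ) :
    Integrable fun ξ : Plane => ‖refProd M ξ‖ ^ 2 := by
  have h1 : Integrable fun x : Plane => ‖(𝓕 φ : Lp ℂ 2 (volume : Measure Plane)) x‖ ^ 2 :=
    (memLp_two_iff_integrable_sq_norm (Lp.aestronglyMeasurable _)).1 (Lp.memLp _)
  have h2 : Integrable fun x : Plane => ‖refProd M ((2 * Real.pi) • x)‖ ^ 2 := by
    refine h1.congr ?_
    filter_upwards [isScalingFunction_iff.1 h] with x hx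
    rw [hx]
  exact (integrable_comp_smul_iff volume (fun ξ : Plane => ‖refProd M ξ‖ ^ 2)
    Real.two_pi_pos.ne').1 h2

lemma exists_isScalingFunction (hM : IsTrigPoly M) (h0 : M 0 = 1)
    (hint : Integrable fun ξ : Plane => ‖refProd M ξ‖ ^ 2) :
    ∃ φ : Lp ℂ 2 (volume : Measure Plane), IsScalingFunction M φ := by
  have h1 : Integrable fun x : Plane => ‖refProd M ((2 * Real.pi) • x)‖ ^ 2 :=
    (integrable_comp_smul_iff volume (fun ξ : Plane => ‖refProd M ξ‖ ^ 2)
      Real.two_pi_pos.ne').2 hint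
  have h2 : MemLp (fun x : Plane => refProd M ((2 * Real.pi) • x)) 2 volume :=
    (memLp_two_iff_integrable_sq_norm ((continuous_refProd hM h0).comp
      (continuous_const_smul _)).aestronglyMeasurable).2 h1
  refine ⟨𝓕⁻ h2.toLp, isScalingFunction_iff.2 ?_⟩
  rw [FourierTransform.fourier_fourierInv_eq]
  exact h2.coeFn_toLp

end ScalingFunction

/-! ### Measures on the torus and their Fourier coefficients -/

/-- The projection of the frequency plane onto the torus. -/
noncomputable def torusProj (ξ : Plane) : UnitAddTorus (Fin 2) :=
  fun i => ((ξ i / (2 * Real.pi) : ℝ) : UnitAddCircle)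

lemma continuous_torusProj : Continuous torusProj := by
  refine continuous_pi fun i => ?_
  exact (AddCircle.continuous_mk' 1).comp (by fun_prop : Continuous fun ξ : Plane =>
    ξ i / (2 * Real.pi))

lemma torusProj_eq_iff (ξ η : Plane) :
    torusProj ξ = torusProj η ↔ ∃ n : Fin 2 → ℤ, ξ = η + (2 * Real.pi) • latticePt n := by
  have hpi := Real.two_pi_pos.ne'
  have key : ∀ i, (torusProj ξ i = torusProj η i ↔ ∃ n : ℤ, ξ i = η i + 2 * Real.pi * n) := by
    intro i
    rw [torusProj, torusProj, ← sub_eq_zero, ← AddCircle.coe_sub, AddCircle.coe_eq_zero_iff]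
    refine exists_congr fun n => ?_
    rw [zsmul_eq_mul, mul_one, ← sub_div, eq_div_iff hpi]
    constructor <;> intro h <;> linarith
  rw [funext_iff]
  simp only [key]
  constructor
  · intro h
    choose n hn using h
    refine ⟨n, PiLp.ext fun i => ?_⟩
    simp [hn i, latticePt_apply]
  · rintro ⟨n, rfl⟩ i
    exact ⟨n i, by simp [latticePt_apply]⟩

lemma injOn_torusProj : Set.InjOn torusProj S₀ := by
  intro ξ hξ η hη h
  obtain ⟨n, hn⟩ := (torusProj_eq_iff ξ η).1 h
  have h0 : n = 0 := (existsUnique_add_mem_S₀ η).unique (show _ ∈ S₀ from hn ▸ hξ)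
    (show _ ∈ S₀ by simpa [latticePt_zero] using hη)
  rw [hn, h0, latticePt_zero, smul_zero, add_zero]

lemma mFourier_torusProj (n : Fin 2 → ℤ) (ξ : Plane) :
    UnitAddTorus.mFourier n (torusProj ξ) = latticeChar n ξ := by
  have hpi : (Real.pi : ℂ) ≠ 0 := Complex.ofReal_ne_zero.2 Real.pi_ne_zero
  simp only [UnitAddTorus.mFourier, ContinuousMap.coe_mk, torusProj, fourier_coe_apply,
    Fin.prod_univ_two, latticeChar, ← Complex.exp_add]
  congr 1
  simp only [PiLp.inner_apply, latticePt_apply, Fin.sum_univ_two]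
  push_cast
  simp
  field_simp

/-- Finite measures on the torus with the same Fourier coefficients agree. -/
lemma ext_of_integral_mFourier {d : Type*} [Fintype d] {μ ν : Measure (UnitAddTorus d)}
    [IsFiniteMeasure μ] [IsFiniteMeasure ν]
    (h : ∀ n : d → ℤ, ∫ x, UnitAddTorus.mFourier n x ∂μ = ∫ x, UnitAddTorus.mFourier n x ∂ν) :
    μ = ν := by
  -- Trigonometric polynomials form a star subalgebra separating points, so their integrals
  -- determine a finite measure; linearity reduces them to characters.
  refine ext_of_forall_mem_subalgebra_integral_eq_of_polish (𝕜 := ℂ)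
    (A := (UnitAddTorus.mFourierSubalgebra d).comap
      (BoundedContinuousFunction.toContinuousMapStarₐ ℂ)) ?_ ?_
  · intro x y hxy
    obtain ⟨f, ⟨g, hg, rfl⟩, hf⟩ := UnitAddTorus.mFourierSubalgebra_separatesPoints (d := d) hxy
    exact ⟨g, ⟨g, ⟨BoundedContinuousFunction.mkOfCompact g, hg, rfl⟩, rfl⟩, hf⟩
  · intro g hg
    have h1 : (BoundedContinuousFunction.toContinuousMapStarₐ ℂ g : C(UnitAddTorus d, ℂ)) ∈
        Submodule.span ℂ (Set.range (UnitAddTorus.mFourier (d := d))) := by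
      rw [← UnitAddTorus.mFourierSubalgebra_coe]
      exact hg
    have hint : ∀ (f : C(UnitAddTorus d, ℂ)) (ρ : Measure (UnitAddTorus d)) [IsFiniteMeasure ρ],
        Integrable f ρ := fun f ρ _ =>
      (BoundedContinuousFunction.mkOfCompact f).integrable ρ
    have h2 : ∀ f ∈ Submodule.span ℂ (Set.range (UnitAddTorus.mFourier (d := d))),
        ∫ x, f x ∂μ = ∫ x, f x ∂ν := by
      intro f hf
      induction hf using Submodule.span_induction with
      | mem f hf => obtain ⟨n, rfl⟩ := hf; exact h n
      | zero => simp
      | add f g _ _ hf hg =>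
        simp only [ContinuousMap.add_apply]
        rw [integral_add (hint f μ) (hint g μ), integral_add (hint f ν) (hint g ν), hf, hg]
      | smul c f _ hf =>
        simp only [ContinuousMap.smul_apply]
        rw [integral_smul, integral_smul, hf]
    exact h2 _ h1

/-- Two measures carried by `S₀` agree as soon as their images on the torus do. -/
lemma eq_of_map_torusProj_eq {μ ν : Measure Plane} (hμ : μ S₀ᶜ = 0) (hν : ν S₀ᶜ = 0)
    (h : μ.map torusProj = ν.map torusProj) : μ = ν := by
  have key : ∀ (ρ : Measure Plane), ρ S₀ᶜ = 0 → ∀ s, MeasurableSet s →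
      ρ s = ρ.map torusProj (torusProj '' (s ∩ S₀)) := by
    intro ρ hρ s hs
    -- Injectivity on the square makes images of its Borel subsets Borel, so the measure can be read
    -- off from its push-forward.
    have hA : MeasurableSet (torusProj '' (s ∩ S₀)) :=
      (hs.inter measurableSet_S₀).image_of_measurable_injOn continuous_torusProj.measurable
        (injOn_torusProj.mono Set.inter_subset_right)
    have hae : ∀ t : Set Plane, ρ t = ρ (t ∩ S₀) := fun t =>
      (measure_inter_conull hρ).symm
    rw [Measure.map_apply continuous_torusProj.measurable hA, hae s, hae (torusProj ⁻¹' _)]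
    congr 1
    ext ξ
    constructor
    · exact fun hξ => ⟨⟨ξ, hξ, rfl⟩, hξ.2⟩
    · rintro ⟨⟨η, hη, hηξ⟩, hξ⟩
      rw [← injOn_torusProj hη.2 hξ hηξ]
      exact hη
  refine Measure.ext fun s hs => ?_
  rw [key μ hμ s hs, key ν hν s hs, h]

/-- The image on the torus of a measure with density `u` only depends on the periodisation. -/
lemma map_torusProj_withDensity {u : Plane → ℝ≥0∞} (hu : Measurable u) :
    (volume.withDensity u).map torusProj =
      ((volume.restrict S₀).withDensity (periodize u)).map torusProj := by
  refine Measure.ext fun A hA => ?_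
  have hA' : MeasurableSet (torusProj ⁻¹' A) := continuous_torusProj.measurable hA
  rw [Measure.map_apply continuous_torusProj.measurable hA,
    Measure.map_apply continuous_torusProj.measurable hA, withDensity_apply _ hA',
    withDensity_apply _ hA', ← lintegral_indicator hA', ← lintegral_indicator hA',
    lintegral_eq_setLIntegral_periodize (hu.indicator hA')]
  refine lintegral_congr fun ξ => ?_
  -- The preimage of a subset of the torus is invariant under the lattice, so its indicator factors
  -- out of the periodisation.
  have h1 : ∀ η (n : Fin 2 → ℤ),
      (torusProj ⁻¹' A).indicator (1 : Plane → ℝ≥0∞) (η + (2 * Real.pi) • latticePt n) =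
        (torusProj ⁻¹' A).indicator 1 η := by
    intro η n
    have h2 : torusProj (η + (2 * Real.pi) • latticePt n) = torusProj η :=
      (torusProj_eq_iff _ _).2 ⟨n, rfl⟩
    have h4 : η + (2 * Real.pi) • latticePt n ∈ torusProj ⁻¹' A ↔ η ∈ torusProj ⁻¹' A := by
      rw [Set.mem_preimage, h2, Set.mem_preimage]
    by_cases h5 : η ∈ torusProj ⁻¹' A
    · rw [Set.indicator_of_mem h5, Set.indicator_of_mem (h4.2 h5)]
      rfl
    · rw [Set.indicator_of_notMem h5, Set.indicator_of_notMem (fun h6 => h5 (h4.1 h6))]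
  have h3 : ∀ (v : Plane → ℝ≥0∞), (torusProj ⁻¹' A).indicator v =
      fun η => (torusProj ⁻¹' A).indicator (1 : Plane → ℝ≥0∞) η * v η := by
    intro v; funext η
    by_cases h : η ∈ torusProj ⁻¹' A <;> simp [h]
  rw [h3 u, periodize_mul_of_periodic h1, h3 (periodize u)]

lemma intervalIntegral_exp_int_mul (n : ℤ) :
    ∫ x in (-Real.pi)..Real.pi, Complex.exp (Complex.I * ((n * x : ℝ) : ℂ)) =
      if n = 0 then ((2 * Real.pi : ℝ) : ℂ) else 0 := by
  split_ifs with hn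
  · subst hn
    simp
    ring
  · have hc : (Complex.I * n : ℂ) ≠ 0 := mul_ne_zero Complex.I_ne_zero (Int.cast_ne_zero.2 hn)
    have h1 := integral_exp_mul_complex (a := -Real.pi) (b := Real.pi) hc
    have h2 : ∀ x : ℝ, Complex.exp (Complex.I * ((n * x : ℝ) : ℂ)) =
        Complex.exp (Complex.I * n * x) := by
      intro x; push_cast; rw [mul_assoc]
    simp_rw [h2, h1]
    rw [div_eq_zero_iff]
    left
    rw [sub_eq_zero, Complex.exp_eq_exp_iff_exists_int]
    exact ⟨n, by push_cast; ring⟩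

lemma setIntegral_S₀_latticeChar (n : Fin 2 → ℤ) :
    ∫ ξ in S₀, latticeChar n ξ = if n = 0 then (((2 * Real.pi) ^ 2 : ℝ) : ℂ) else 0 := by
  have h1 : ∫ ξ in S₀, latticeChar n ξ = ∫ x in Set.univ.pi fun _ : Fin 2 =>
      Set.Ico (-Real.pi) Real.pi, ∏ i, Complex.exp (Complex.I * ((n i * x i : ℝ) : ℂ)) := by
    rw [S₀_eq_preimage, ← (EuclideanSpace.volume_preserving_symm_measurableEquiv_toLp
      (Fin 2)).setIntegral_preimage_emb (MeasurableEquiv.measurableEmbedding _)]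
    refine setIntegral_congr_fun (S₀_eq_preimage ▸ measurableSet_S₀) fun ξ _ => ?_
    simp only [latticeChar, ← Complex.exp_sum, ← Finset.mul_sum]
    congr 2
    simp [PiLp.inner_apply, latticePt_apply, Fin.sum_univ_two, mul_comm]
  rw [h1, volume_pi, Measure.restrict_pi_pi, integral_fintype_prod_eq_prod
    (f := fun i (x : ℝ) => Complex.exp (Complex.I * ((n i * x : ℝ) : ℂ)))]
  have h2 : ∀ i, ∫ x in Set.Ico (-Real.pi) Real.pi,
      Complex.exp (Complex.I * ((n i * x : ℝ) : ℂ)) = if n i = 0 then ((2 * Real.pi : ℝ) : ℂ) else 0 := by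
    intro i
    rw [← intervalIntegral_exp_int_mul, integral_Ico_eq_integral_Ioc,
      intervalIntegral.integral_of_le (by linarith [Real.pi_pos])]
  simp_rw [h2, Fin.prod_univ_two, funext_iff, Fin.forall_fin_two, Pi.zero_apply]
  by_cases ha : n 0 = 0 <;> by_cases hb : n 1 = 0 <;> simp [ha, hb]
  ring

/-! ### Orthonormality, the periodised density and the mirror filter -/

section Orthonormality

variable {M : Plane → ℂ} {φ : Lp ℂ 2 (volume : Measure Plane)}

/-- Orthonormality of the integer shifts means that the periodised density is `1` almost
everywhere. -/
lemma orthonormal_shift_iff (hM : IsTrigPoly M) (h0 : M 0 = 1) (h : IsScalingFunction M φ) :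
    Orthonormal ℂ (fun n : Fin 2 → ℤ => shift n φ) ↔
      periodize (specDensity M) =ᵐ[volume.restrict S₀] 1 := by
  have hmeas := measurable_specDensity hM h0
  have hint := integrable_normSq_refProd h
  have hfinS : volume S₀ ≠ ∞ := by rw [volume_S₀]; exact ENNReal.ofReal_ne_top
  have : IsFiniteMeasure ((volume : Measure Plane).restrict S₀) :=
    ⟨by rw [Measure.restrict_apply_univ]; exact hfinS.lt_top⟩
  have : IsFiniteMeasure ((volume : Measure Plane).withDensity (specDensity M)) :=
    isFiniteMeasure_withDensity_ofReal hint.2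
  have hI : ∀ n, ∫ t, UnitAddTorus.mFourier n t ∂(volume.withDensity (specDensity M)).map torusProj
      = ∫ ξ, (‖refProd M ξ‖ ^ 2) • latticeChar n ξ := by
    intro n
    rw [integral_map continuous_torusProj.aemeasurable (by fun_prop)]
    simp_rw [mFourier_torusProj]
    rw [integral_withDensity_eq_integral_toReal_smul hmeas
      (Eventually.of_forall fun _ => ENNReal.ofReal_lt_top)]
    refine integral_congr_ae (Eventually.of_forall fun ξ => ?_)
    simp only [specDensity]
    rw [ENNReal.toReal_ofReal (by positivity)]
  have hJ : ∀ n, ∫ t, UnitAddTorus.mFourier n t ∂(volume.restrict S₀).map torusProj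
      = if n = 0 then (((2 * Real.pi) ^ 2 : ℝ) : ℂ) else 0 := by
    intro n
    rw [integral_map continuous_torusProj.aemeasurable (by fun_prop), ← setIntegral_S₀_latticeChar]
    simp_rw [mFourier_torusProj]
  -- The inner products depend only on m - n, so orthonormality states that the pushed density has
  -- coefficients (2π)² at 0 and zero elsewhere, which are those of Lebesgue measure on the square.
  have horth : Orthonormal ℂ (fun n : Fin 2 → ℤ => shift n φ) ↔
      (volume.withDensity (specDensity M)).map torusProj =
        (volume.restrict S₀).map torusProj := by
    have hpi : ((2 * Real.pi) ^ 2 : ℝ) ≠ 0 := by positivity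
    rw [orthonormal_iff_ite]
    constructor
    · intro ho
      refine ext_of_integral_mFourier fun n => ?_
      rw [hI, hJ]
      have h1 := ho n 0
      rw [inner_shift_shift h, sub_zero] at h1
      rw [inv_smul_eq_iff₀ hpi] at h1
      rw [h1]
      split_ifs <;> simp
    · intro he m n
      rw [inner_shift_shift h, ← hI, he, hJ, inv_smul_eq_iff₀ hpi]
      simp only [sub_eq_zero]
      split_ifs <;> simp
  rw [horth, map_torusProj_withDensity hmeas]
  constructor
  · intro he
    have h1 : (volume.restrict S₀).withDensity (periodize (specDensity M)) =
        volume.restrict S₀ := by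
      have h2 : (volume.restrict S₀ : Measure Plane) S₀ᶜ = 0 := by
        rw [Measure.restrict_apply measurableSet_S₀.compl, Set.compl_inter_self, measure_empty]
      exact eq_of_map_torusProj_eq (withDensity_absolutelyContinuous _ _ h2) h2 he
    refine (withDensity_eq_iff_of_sigmaFinite (measurable_periodize hmeas).aemeasurable
      aemeasurable_one).1 (h1.trans withDensity_one.symm)
  · intro he
    rw [withDensity_congr_ae he, withDensity_one]

end Orthonormality

/-- The measure of the exceptional set is the integral over the square of its periodised indicator,
which vanishes almost everywhere there. -/
lemma ae_of_ae_restrict_S₀ {p : Plane → Prop} (hp : MeasurableSet {ξ | p ξ})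
    (hper : ∀ ξ (n : Fin 2 → ℤ), p (ξ + (2 * Real.pi) • latticePt n) → p ξ)
    (h : ∀ᵐ ξ ∂volume.restrict S₀, p ξ) : ∀ᵐ ξ, p ξ := by
  rw [ae_iff, ← Set.compl_ofPred, ← lintegral_indicator_one hp.compl,
    lintegral_eq_setLIntegral_periodize (measurable_one.indicator hp.compl)]
  refine (lintegral_congr_ae ?_).trans lintegral_zero
  filter_upwards [h] with ξ hξ
  rw [periodize, ENNReal.tsum_eq_zero]
  intro n
  have hn : p (ξ + (2 * Real.pi) • latticePt n) := by
    refine hper _ (-n) ?_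
    simpa [latticePt_neg] using hξ
  exact Set.indicator_of_notMem (by simpa using hn) _

/-- If the periodised density is `1` almost everywhere, the quadrature mirror filter identity
holds. -/
lemma isQMF_of_periodize_ae_eq_one {M : Plane → ℂ} (hM : IsTrigPoly M) (h0 : M 0 = 1)
    (h : periodize (specDensity M) =ᵐ[volume.restrict S₀] 1) : IsQMF M := by
  have hmeas := measurable_periodize (measurable_specDensity hM h0)
  have h1 : ∀ᵐ ξ : Plane, periodize (specDensity M) ξ = 1 :=
    ae_of_ae_restrict_S₀ (hmeas (measurableSet_singleton 1))
      (fun ξ n hn => by rwa [periodize_add] at hn) h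
  have h2 : ∀ᵐ ξ : Plane, ∀ γ ∈ Γ, periodize (specDensity M) (ξ + γ) = 1 := by
    rw [Finset.eventually_all]
    exact fun γ _ => (measurePreserving_add_right volume γ).quasiMeasurePreserving.ae h1
  have h3 : ∀ᵐ ξ : Plane, periodize (specDensity M) ((2 : ℝ) • ξ) = 1 :=
    (Measure.quasiMeasurePreserving_smul volume two_ne_zero).ae h1
  -- At 2ξ the refinement equation reads 1 = ∑ |M(ξ + γ)|² · 1 for almost every ξ; continuity then
  -- removes the exceptional set.
  have h4 : (fun ξ : Plane => ∑ γ ∈ Γ, ‖M (ξ + γ)‖ ^ 2) =ᵐ[volume] fun _ => 1 := by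
    filter_upwards [h2, h3] with ξ h5 h6
    rw [periodize_specDensity_eq hM h0, smul_smul, inv_mul_cancel₀ two_ne_zero, one_smul] at h6
    rw [Finset.sum_congr rfl fun γ hγ => by rw [h5 γ hγ, mul_one],
      ← ENNReal.ofReal_sum_of_nonneg fun γ _ => by positivity] at h6
    exact (ENNReal.ofReal_eq_one).1 h6
  have hcont : Continuous fun ξ : Plane => ∑ γ ∈ Γ, ‖M (ξ + γ)‖ ^ 2 := by
    have := hM.continuous
    fun_prop
  exact fun ξ => congrFun ((hcont.ae_eq_iff_eq volume continuous_const).1 h4) ξ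

/-! ### Compact sets congruent to the square -/

lemma convex_S₀ : Convex ℝ S₀ := by
  intro x hx y hy a b ha hb hab i
  exact convex_Ico _ _ (hx i) (hy i) ha hb hab

lemma S₀_subset_closedBall : S₀ ⊆ Metric.closedBall (0 : Plane) (2 * Real.pi) := by
  intro ξ hξ
  rw [mem_closedBall_zero_iff]
  refine (norm_le_sum_abs _).trans ?_
  rw [Fin.sum_univ_two]
  have := abs_le.2 ⟨(hξ 0).1, (hξ 0).2.le⟩
  have := abs_le.2 ⟨(hξ 1).1, (hξ 1).2.le⟩
  linarith

/-- The periodised indicator of a covering set is at least 1 on the square. -/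
lemma volume_S₀_le_of_covers {K : Set Plane} (hK : MeasurableSet K) (hcov : Covers K) :
    volume S₀ ≤ volume K := by
  rw [← lintegral_indicator_one hK,
    lintegral_eq_setLIntegral_periodize (measurable_one.indicator hK), ← setLIntegral_one]
  refine setLIntegral_mono' measurableSet_S₀ fun ξ hξ => ?_
  obtain ⟨n, hn⟩ := hcov ξ hξ
  refine le_trans ?_ (ENNReal.le_tsum n)
  rw [Set.indicator_of_mem hn, Pi.one_apply]

lemma volume_frontier_diff {s t : Set Plane} (hs : volume (frontier s) = 0)
    (ht : volume (frontier t) = 0) : volume (frontier (s \ t)) = 0 := by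
  refine measure_mono_null ?_ (measure_union_null hs ht)
  rw [Set.sdiff_eq]
  refine (frontier_inter_subset _ _).trans ?_
  rw [frontier_compl]
  exact Set.union_subset_union Set.inter_subset_left Set.inter_subset_right

/-- Moving pieces of a set into an open set meeting all lattice orbits. -/
lemma exists_compact_translate {Ω : Set Plane} (hΩ : IsOpen Ω)
    (hcov : ∀ ξ : Plane, ∃ n : Fin 2 → ℤ, ξ + (2 * Real.pi) • latticePt n ∈ Ω)
    {s : Set Plane} (hs : IsCompact s) :
    ∃ s' : Set Plane, s ⊆ s' ∧ MeasurableSet s' ∧ volume (frontier s') = 0 ∧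
      ∀ T : Set Plane, MeasurableSet T → Bornology.IsBounded T → volume (frontier T) = 0 →
        ∃ K ⊆ Ω, IsCompact K ∧
          (∀ ξ ∈ T ∩ s', ∃ n : Fin 2 → ℤ, ξ + (2 * Real.pi) • latticePt n ∈ K) ∧
          volume K ≤ volume (T ∩ s') := by
  -- Compact induction. The claim quantifies over all T so that, for a union, the second set can be
  -- applied to T \ s'; the pieces are then disjoint and no volume is counted twice.
  refine hs.induction_on ?_ ?_ ?_ ?_
  · exact ⟨∅, subset_rfl, MeasurableSet.empty, by simp, fun T _ _ _ =>
      ⟨∅, Set.empty_subset _, isCompact_empty, by simp, by simp⟩⟩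
  · intro s t hst ht
    obtain ⟨s', h1, h2⟩ := ht
    exact ⟨s', hst.trans h1, h2⟩
  · intro s t hs ht
    obtain ⟨s', hs1, hs2, hs3, hs4⟩ := hs
    obtain ⟨t', ht1, ht2, ht3, ht4⟩ := ht
    refine ⟨s' ∪ t', Set.union_subset_union hs1 ht1, hs2.union ht2, ?_, fun T hT hTb hTf => ?_⟩
    · refine measure_mono_null ((frontier_union_subset _ _).trans ?_) (measure_union_null hs3 ht3)
      exact Set.union_subset_union Set.inter_subset_left Set.inter_subset_right
    · obtain ⟨K₁, h1, h2, h3, h4⟩ := hs4 T hT hTb hTf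
      obtain ⟨K₂, h5, h6, h7, h8⟩ := ht4 (T \ s') (hT.diff hs2) (hTb.subset Set.sdiff_subset)
        (volume_frontier_diff hTf hs3)
      refine ⟨K₁ ∪ K₂, Set.union_subset h1 h5, h2.union h6, fun ξ hξ => ?_, ?_⟩
      · by_cases h : ξ ∈ s'
        · obtain ⟨n, hn⟩ := h3 ξ ⟨hξ.1, h⟩
          exact ⟨n, Or.inl hn⟩
        · obtain ⟨n, hn⟩ := h7 ξ ⟨⟨hξ.1, h⟩, hξ.2.resolve_left h⟩
          exact ⟨n, Or.inr hn⟩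
      · have hd : T ∩ (s' ∪ t') = (T ∩ s') ∪ ((T \ s') ∩ t') := by
          ext ξ
          simp only [Set.mem_inter_iff, Set.mem_union, Set.mem_sdiff]
          tauto
        rw [hd, measure_union ?_ ((hT.diff hs2).inter ht2)]
        · exact (measure_union_le _ _).trans (add_le_add h4 h8)
        · exact Set.disjoint_left.2 fun ξ ha hb => hb.1.2 ha.2
  · intro x _
    obtain ⟨n, hn⟩ := hcov x
    obtain ⟨r, hr, hball⟩ := Metric.nhds_basis_closedBall.mem_iff.1 (hΩ.mem_nhds hn)
    refine ⟨Metric.closedBall x r, mem_nhdsWithin_of_mem_nhds (Metric.closedBall_mem_nhds x hr),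
      Metric.closedBall x r, subset_rfl, measurableSet_closedBall,
      (convex_closedBall x r).addHaar_frontier volume, fun T hT hTb hTf => ?_⟩
    set v := (2 * Real.pi) • latticePt n
    set C := T ∩ Metric.closedBall x r
    have hC : volume (frontier C) = 0 := by
      refine measure_mono_null ((frontier_inter_subset _ _).trans ?_)
        (measure_union_null hTf ((convex_closedBall x r).addHaar_frontier volume))
      exact Set.union_subset_union Set.inter_subset_left Set.inter_subset_right
    have hCb : closure C ⊆ Metric.closedBall x r :=
      closure_minimal Set.inter_subset_right Metric.isClosed_closedBall
    -- Closing the piece makes it compact, keeps it in the ball that translates into Ω, and adds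
    -- only part of a null frontier.
    refine ⟨(fun y => y + v) '' closure C, ?_, ?_, fun ξ hξ => ⟨n, ξ, subset_closure hξ, rfl⟩, ?_⟩
    · rintro _ ⟨y, hy, rfl⟩
      refine hball ?_
      have := hCb hy
      rwa [Metric.mem_closedBall, dist_add_right]
    · exact ((isCompact_closedBall x r).of_isClosed_subset isClosed_closure hCb).image
        (continuous_add_const v)
    · rw [Set.image_add_right, measure_preimage_add_right, measure_closure_of_null_frontier hC]

/-- An open neighbourhood of the origin meeting all lattice orbits contains a compact
neighbourhood of the origin congruent to `S₀`. -/
lemma exists_compact_congruent {Ω : Set Plane} (hΩ : IsOpen Ω) (h0 : (0 : Plane) ∈ Ω)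
    (hcov : ∀ ξ : Plane, ∃ n : Fin 2 → ℤ, ξ + (2 * Real.pi) • latticePt n ∈ Ω) :
    ∃ K ⊆ Ω, IsCompact K ∧ K ∈ 𝓝 (0 : Plane) ∧ Covers K ∧
      volume K = ENNReal.ofReal ((2 * Real.pi) ^ 2) := by
  obtain ⟨r, hr, hball⟩ := Metric.nhds_basis_closedBall.mem_iff.1
    (Filter.inter_mem (hΩ.mem_nhds h0) S₀_mem_nhds_zero)
  set B := Metric.closedBall (0 : Plane) r
  have hB : MeasurableSet B := measurableSet_closedBall
  obtain ⟨s, h1, -, -, h2⟩ := exists_compact_translate hΩ hcov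
    (isCompact_closedBall (0 : Plane) (2 * Real.pi))
  -- The ball B stays in place to provide the neighbourhood of 0; only the rest of the square is
  -- moved.
  obtain ⟨K, h3, h4, h5, h6⟩ := h2 (S₀ \ B) (measurableSet_S₀.diff hB)
    ((Metric.isBounded_closedBall.subset S₀_subset_closedBall).subset Set.sdiff_subset)
    (volume_frontier_diff (convex_S₀.addHaar_frontier volume)
      ((convex_closedBall _ _).addHaar_frontier volume))
  have hKc : IsCompact (K ∪ B) := h4.union (isCompact_closedBall _ _)
  have hKcov : Covers (K ∪ B) := by
    intro ξ hξ
    by_cases h : ξ ∈ B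
    · exact ⟨0, Or.inr (by simpa [latticePt_zero] using h)⟩
    · obtain ⟨n, hn⟩ := h5 ξ ⟨⟨hξ, h⟩, h1 (S₀_subset_closedBall hξ)⟩
      exact ⟨n, Or.inl hn⟩
  refine ⟨K ∪ B, Set.union_subset h3 fun ξ hξ => (hball hξ).1, hKc,
    mem_of_superset (Metric.closedBall_mem_nhds 0 hr) Set.subset_union_right, hKcov, ?_⟩
  rw [← volume_S₀]
  -- The pieces have total volume at most that of the square, and covering forces the reverse
  -- inequality.
  refine le_antisymm ?_ (volume_S₀_le_of_covers hKc.measurableSet hKcov)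
  calc volume (K ∪ B) ≤ volume K + volume B := measure_union_le _ _
    _ ≤ volume (S₀ \ B) + volume B :=
        add_le_add_left (h6.trans (measure_mono Set.inter_subset_left)) _
    _ = volume S₀ := by
      rw [measure_sdiff (fun ξ hξ => (hball hξ).2) hB.nullMeasurableSet
        measure_closedBall_lt_top.ne, tsub_add_cancel_of_le (measure_mono fun ξ hξ => (hball hξ).2)]

/-! ### Lower bounds on the mask and nonvanishing on orbits -/

/-- For large k the set 2⁻ᵏK lies near 0, where |M| > |M(0)|/2; each of the finitely many remaining
k has a positive minimum by compactness. -/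
lemma boundedBelow_of_isCompact {M : Plane → ℂ} (hM : Continuous M) (h0 : M 0 ≠ 0) {K : Set Plane}
    (hK : IsCompact K) (hne : ∀ ξ ∈ K, ∀ k : ℕ, M (dilInv (k + 1) ξ) ≠ 0) : BoundedBelow M K := by
  have h1 : ∀ N : ℕ, ∃ c : ℝ, 0 < c ∧ ∀ k < N, ∀ ξ ∈ K, c ≤ ‖M (dilInv (k + 1) ξ)‖ := by
    intro N
    induction N with
    | zero => exact ⟨1, one_pos, by simp⟩
    | succ N ih =>
      obtain ⟨c, hc, hcb⟩ := ih
      obtain ⟨c', hc', hcb'⟩ := hK.exists_forall_le'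
        (f := fun ξ => ‖M (dilInv (N + 1) ξ)‖)
        (hM.comp (continuous_dilInv _)).norm.continuousOn (a := 0)
        fun ξ hξ => norm_pos_iff.2 (hne ξ hξ N)
      refine ⟨min c c', lt_min hc hc', fun k hk ξ hξ => ?_⟩
      rcases Nat.lt_succ_iff_lt_or_eq.1 hk with h | rfl
      · exact (min_le_left _ _).trans (hcb k h ξ hξ)
      · exact (min_le_right _ _).trans (hcb' ξ hξ)
  have hpos : 0 < ‖M 0‖ := norm_pos_iff.2 h0
  have h2 : ∀ᶠ η in 𝓝 (0 : Plane), ‖M 0‖ / 2 < ‖M η‖ :=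
    (hM.norm.tendsto 0).eventually (lt_mem_nhds (half_lt_self hpos))
  obtain ⟨δ, hδ, hb⟩ := Metric.eventually_nhds_iff.1 h2
  obtain ⟨R, hR⟩ := hK.isBounded.exists_norm_le
  have h3 : Tendsto (fun k : ℕ => (1 / 2 : ℝ) ^ k * R) atTop (𝓝 0) := by
    simpa using (tendsto_pow_atTop_nhds_zero_of_lt_one (r := (1 / 2 : ℝ)) (by norm_num)
      (by norm_num)).mul_const R
  obtain ⟨N, hN⟩ := eventually_atTop.1 (h3.eventually (gt_mem_nhds hδ))
  obtain ⟨c, hc, hcb⟩ := h1 N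
  refine ⟨min c (‖M 0‖ / 2), lt_min hc (half_pos hpos), fun k hk ξ hξ => ?_⟩
  obtain ⟨j, rfl⟩ : ∃ j, k = j + 1 := ⟨k - 1, by omega⟩
  rcases lt_or_ge j N with h | h
  · exact (min_le_left _ _).trans (hcb j h ξ hξ)
  · refine (min_le_right _ _).trans (hb ?_).le
    rw [dist_zero_right, norm_dilInv]
    exact (mul_le_mul_of_nonneg_left (hR ξ hξ) (by positivity)).trans_lt (hN (j + 1) (by omega))

lemma exists_ne_zero_of_periodize_eq_one {M : Plane → ℂ} {ξ : Plane}
    (h : periodize (specDensity M) ξ = 1) :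
    ∃ n : Fin 2 → ℤ, refProd M (ξ + (2 * Real.pi) • latticePt n) ≠ 0 := by
  by_contra! hc
  simp [periodize, specDensity, hc] at h

/-- A covering set on which the dilated mask does not vanish yields a nonzero value of the product
on every lattice orbit. -/
lemma exists_refProd_ne_zero_of_covers {M : Plane → ℂ} (hM : IsTrigPoly M) (h0 : M 0 = 1)
    {K : Set Plane} (hcov : Covers K) (hb : BoundedBelow M K) (ξ : Plane) :
    ∃ n : Fin 2 → ℤ, refProd M (ξ + (2 * Real.pi) • latticePt n) ≠ 0 := by
  obtain ⟨c, hc, hb⟩ := hb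
  obtain ⟨m, hm, -⟩ := existsUnique_add_mem_S₀ ξ
  obtain ⟨n, hn⟩ := hcov _ hm
  refine ⟨m + n, ?_⟩
  rw [latticePt_add, smul_add, ← add_assoc, refProd_ne_zero_iff hM h0]
  exact fun k => norm_pos_iff.1 (hc.trans_le (hb (k + 1) k.succ_pos _ hn))

lemma IsQMF.integrable_normSq_refProd {M : Plane → ℂ} (h : IsQMF M) (hM : IsTrigPoly M)
    (h0 : M 0 = 1) : Integrable fun ξ : Plane => ‖refProd M ξ‖ ^ 2 := by
  have hc : Continuous fun ξ => ‖refProd M ξ‖ ^ 2 := (continuous_refProd hM h0).norm.pow 2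
  refine ⟨hc.aestronglyMeasurable, ?_⟩
  rw [hasFiniteIntegral_iff_ofReal (Eventually.of_forall fun ξ => by positivity)]
  change ∫⁻ ξ, specDensity M ξ < ∞
  rw [lintegral_eq_setLIntegral_periodize (measurable_specDensity hM h0)]
  refine (lintegral_mono fun ξ => h.periodize_specDensity_le_one hM h0 ξ).trans_lt ?_
  rw [setLIntegral_one, volume_S₀]
  exact ENNReal.ofReal_lt_top

end QuasiShearlet

/-! ### The two implications -/

theorem theorem2 (M₀ : Plane → ℂ) (hM₀ : IsTrigPoly M₀) (h0 : M₀ 0 = 1) :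
    -- orthonormality of the integer shifts gives the set `K`
    (∀ φ : Lp ℂ 2 (volume : Measure Plane), IsScalingFunction M₀ φ →
      Orthonormal ℂ (fun n : Fin 2 → ℤ => shift n φ) →
      ∃ K : Set Plane, IsCompact K ∧ K ∈ 𝓝 (0 : Plane) ∧ Covers K ∧
        volume K = ENNReal.ofReal ((2 * Real.pi) ^ 2) ∧ BoundedBelow M₀ K) ∧
    -- the converse; here `K` need be neither compact nor of measure `(2π)²`
    ((∀ ξ : Plane, ∑ γ ∈ Γ, ‖M₀ (ξ + γ)‖ ^ 2 = 1) →
      (∃ φ : Lp ℂ 2 (volume : Measure Plane), IsScalingFunction M₀ φ) ∧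
      ∀ φ : Lp ℂ 2 (volume : Measure Plane), IsScalingFunction M₀ φ →
        (∃ K : Set Plane, K ∈ 𝓝 (0 : Plane) ∧ Covers K ∧ BoundedBelow M₀ K) →
        Orthonormal ℂ (fun n : Fin 2 → ℤ => shift n φ)) := by
  refine ⟨fun φ hφ horth => ?_, fun hQ => ⟨?_, fun φ hφ hK => ?_⟩⟩
  · have hae := (orthonormal_shift_iff hM₀ h0 hφ).1 horth
    have hQ : IsQMF M₀ := isQMF_of_periodize_ae_eq_one hM₀ h0 hae
    have hcont := hQ.continuous_periodize_specDensity hM₀ h0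
    have hae' : ∀ᵐ ξ : Plane, (periodize (specDensity M₀) ξ).toReal = 1 := by
      refine ae_of_ae_restrict_S₀ (hcont.measurable (measurableSet_singleton 1))
        (fun ξ n hn => by rwa [periodize_add] at hn) ?_
      filter_upwards [hae] with ξ hξ
      simp [hξ]
    -- Equality at every point, not just almost everywhere, is needed for {P ≠ 0} to meet every
    -- orbit.
    have hone : ∀ ξ, periodize (specDensity M₀) ξ = 1 := fun ξ =>
      (ENNReal.toReal_eq_one_iff _).1
        (congrFun ((hcont.ae_eq_iff_eq volume continuous_const).1 hae') ξ)
    have hprod := continuous_refProd hM₀ h0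
    obtain ⟨K, hKΩ, hKc, hK0, hKcov, hKvol⟩ := exists_compact_congruent
      (Ω := {ξ | refProd M₀ ξ ≠ 0}) (isOpen_ne_fun hprod continuous_const)
      (by simp [refProd_zero h0]) fun ξ => exists_ne_zero_of_periodize_eq_one (hone ξ)
    exact ⟨K, hKc, hK0, hKcov, hKvol, boundedBelow_of_isCompact hM₀.continuous (by simp [h0]) hKc
      fun ξ hξ => (refProd_ne_zero_iff hM₀ h0 ξ).1 (hKΩ hξ)⟩
  · exact exists_isScalingFunction hM₀ h0 (IsQMF.integrable_normSq_refProd hQ hM₀ h0)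
  · obtain ⟨K, -, hcov, hb⟩ := hK
    refine (orthonormal_shift_iff hM₀ h0 hφ).2 (Filter.Eventually.of_forall fun ξ => ?_)
    exact IsQMF.periodize_specDensity_eq_one hQ hM₀ h0
      (exists_refProd_ne_zero_of_covers hM₀ h0 hcov hb) ξ
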